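/- For $c\in\Omega:=\mathbb{C}\setminus([-1,0)\cup(0,1])$ let $g_k=g_k(c)=\frac1{2\pi}\int_0^{2\pi}\frac{\sin\eta}{c+\sin\eta}\,e^{-ik\eta}\,d\eta$ ($k\in\mathbb{Z}$) be the Fourier coefficients of $Q(\eta)=\frac{\sin\eta}{c+\sin\eta}$, let $$D(\Lambda)=\lim_{N\to\infty}\det\left(\delta_{n,m}+\frac{\tilde g_{n-m}}{\Lambda-n^2}\right)_{-N\le n,m\le N},\qquad \tilde g_0=0,\quad \tilde g_k=g_k\ (k\ne0),$$ be the Hill determinant of $g''+Qg=\mu g$, and let $$E(c;\theta,d)=-2+2\cos(2\pi\theta)+4\,D(g_0-d^2)\,\sin^2\!\big(\pi\sqrt{g_0-d^2}\big)$$ be the Evans function, where $\theta,d\in\mathbb{R}$. Let $l\in\mathbb{Z}$ and let $t\mapsto(\theta(t),d(t))\in\mathbb{R}^2$ be a curve, $C^1$ near $t=0$, which at $t=0$ crosses the circle $(\theta+l)^2+d^2=1$ from outside to inside, that is, $(\theta(0)+l)^2+d(0)^2=1$ and the inward normal speed $v:=-\big((\theta(0)+l)\,\theta'(0)+d(0)\,d'(0)\big)$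 is positive. Suppose that $d(0)\notin\{0,\pm\tfrac{\sqrt3}{2},\pm1\}$. Then a pair of purely imaginary roots of $E$ is born at $c=0$: there are $\varepsilon,\delta>0$ and a continuous function $y:[0,\delta)\to[0,\infty)$ with $y(0)=0$ and $y(t)>0$ for $0<t<\delta$ such that 1. for $|t|<\delta$ and $c\in\Omega$ with $|c|<\varepsilon$ the number $\Lambda=g_0-d(t)^2$ is not the square of an integer and the limit defining $D(\Lambda)$ exists; 2. the set of roots $c\in\Omega$ of $E(\,\cdot\,;\theta(t),d(t))$ with $|c|<\varepsilon$ is empty for $-\delta<t<0$, is $\{0\}$ for $t=0$, and is $\{iy(t),-iy(t)\}$ for $0<t<\delta$; 3. the two root curves $c(t)=\pm iy(t)$ have the one-sided derivatives $\frac{dc}{dt}\big|_{t=0^+}=\pm2iv$; in particular $\frac{dc}{dt}\big|_{t=0^+}=\pm2i$ if the circle is crossed in the normal direction with unit speed. -/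

import Mathlib

open Filter Topology

noncomputable section

/-- The potential `Q(η) = sin η / (c + sin η)` of Hill's equation `g'' + Q g = μ g`. For `c = 0`
it equals `1` except at the zeros of `sin`, a null set. -/
def hillPotential (c : ℂ) (η : ℝ) : ℂ :=
  (Real.sin η : ℂ) / (c + (Real.sin η : ℂ))

/-- The Fourier coefficient `g_k = (1 / 2π) ∫_0^{2π} Q(η) e^{-ikη} dη` of the potential. -/
def hillCoeff (c : ℂ) (k : ℤ) : ℂ :=
  (1 / (2 * (Real.pi : ℂ))) *
    ∫ η in (0 : ℝ)..(2 * Real.pi),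
      hillPotential c η * Complex.exp (-(Complex.I * (k : ℂ) * (η : ℂ)))

/-- The entry in row `n` and column `m` of Hill's bi-infinite matrix:
`δ_{n,m} + g̃_{n-m} / (Λ - n²)`, where `g̃_0 = 0` and `g̃_k = g_k` for `k ≠ 0`. -/
def hillEntry (c Λ : ℂ) (n m : ℤ) : ℂ :=
  if n = m then 1 else hillCoeff c (n - m) / (Λ - (n : ℂ) ^ 2)

/-- The central `(2N+1) × (2N+1)` truncation, with indices `-N, …, N`, of Hill's determinant. -/
def hillDetTrunc (c Λ : ℂ) (N : ℕ) : ℂ :=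
  Matrix.det (Matrix.of fun n m : ↥(Finset.Icc (-(N : ℤ)) (N : ℤ)) =>
    hillEntry c Λ (n : ℤ) (m : ℤ))

/-- Hill's determinant `D(Λ)`, the limit of its central truncations. -/
def hillDet (c Λ : ℂ) : ℂ :=
  limUnder atTop (hillDetTrunc c Λ)

/-- The Evans function
`E(c; θ, d) = -2 + 2 cos(2πθ) + 4 D(g₀ - d²) sin²(π √(g₀ - d²))`
(`sin²(π √Λ)` does not depend on the choice of the square root). -/
def evansE (c : ℂ) (θ d : ℝ) : ℂ :=
  -2 + 2 * (Real.cos (2 * Real.pi * θ) : ℂ) +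
    4 * hillDet c (hillCoeff c 0 - (d : ℂ) ^ 2) *
      Complex.sin ((Real.pi : ℂ) * (hillCoeff c 0 - (d : ℂ) ^ 2) ^ (1 / 2 : ℂ)) ^ 2

/-- The set `ℂ \ ([-1, 0) ∪ (0, 1])` of those `c` for which the Evans function is defined: for the
excluded real `c ≠ 0` the potential has a non-integrable singularity. -/
def evansDomain : Set ℂ :=
  {c : ℂ | c = 0 ∨ ∀ x : ℝ, x ∈ Set.Icc (-1 : ℝ) 1 → c ≠ (x : ℂ)}

/-- The roots `c` of `E(·; θ, d)` at distance less than `ε` from the origin. -/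
def evansRootsNear (ε θ d : ℝ) : Set ℂ :=
  {c : ℂ | c ∈ evansDomain ∧ ‖c‖ < ε ∧ evansE c θ d = 0}

end

/-!
Write `a = i c / √(1 - c²)` and `w = i c + √(1 - c²)`. For `c` in the upper half-plane, near `0`,
one has `‖w‖ < 1`, and expanding `1 / (c + sin η)` into two geometric series gives
`g_0 = 1 + a`, `g_k = a w^k` for `k > 0` and `g_k = a (-w)^|k|` for `k < 0`
(`hillCoeff_of_im_pos`). Hence every off-diagonal entry in row `n` of Hill's matrix is at most
`2 ‖c‖ / |Λ - n²|`, and these bounds are summable over `n`. Adjoining the indices one at a time and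
estimating each Schur complement (`RowBounded.norm_principalMinor_insert_sub_le`) shows that the
determinant converges and is `1 + O(c²)` uniformly in the half-disc, also where `‖w‖` is close
to `1` (`exists_hillDet_bound`).

With `S(z) = sin² (π √z)` the Evans function is `4 (D S(1 + a - d²) - S((θ + l)²))`. Together with
the equation of the circle, the conditions on `d 0` say that `1 - d²` lies in `(0, 1)` at `t = 0`
and that `S` has derivative `κ ≠ 0` there. As `a = i c + O(c²)`, this gives `E / (4 κ) ≈ i c - ρ`
with `ρ = (θ + l)² + d² - 1`, up to a small multiple of `i c - ρ` and a quadratic error. Since `ρ ≈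
-2 v t`, a root in the upper half-plane or at `0` can exist only for `t ≥ 0`, and it is within
`O(ρ²)` of `-i ρ`. In the disc of radius `|ρ| / 4` about `-i ρ`, which stays away from the real
axis, Cauchy's estimate turns `D = 1 + O(c²)` into a Lipschitz bound for `D` with constant `O(ρ)`,
so that `E / (4 κ)` is injective there. Finally `E` is real on the imaginary axis, so that the
intermediate value theorem produces the root `i y(t)` (`exists_root_curve`). The roots in the lower
half-plane follow from `E(-c) = E(c)`.
-/

noncomputable section

/-! ### Fourier coefficients of the potential -/

/-- The square root `√(1 - c²)`, with positive real part for `‖c‖ < 1`. -/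
def hillRoot (c : ℂ) : ℂ := (1 - c ^ 2) ^ (1 / 2 : ℂ)

/-- The amplitude `a = i c / √(1 - c²)` of the Fourier coefficients in the upper half-plane. -/
def hillAmp (c : ℂ) : ℂ := Complex.I * c / hillRoot c

/-- The ratio `w = i c + √(1 - c²)` of the Fourier coefficients in the upper half-plane. -/
def hillRatio (c : ℂ) : ℂ := Complex.I * c + hillRoot c

/-- The two-sided geometric sequence: `w ^ k` for `k ≥ 0`, and `(-w) ^ |k|` for `k < 0`. -/
def twoSidedPow (w : ℂ) (k : ℤ) : ℂ :=
  if 0 ≤ k then w ^ k.natAbs else (-w) ^ k.natAbs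

lemma one_sub_sq_re_pos {c : ℂ} (hc : ‖c‖ < 1) : 0 < (1 - c ^ 2).re := by
  have h : ‖c ^ 2‖ < 1 := by
    rw [norm_pow]; nlinarith [norm_nonneg c]
  have := (abs_le.1 (Complex.abs_re_le_norm (c ^ 2))).2
  simp only [Complex.sub_re, Complex.one_re]
  linarith

lemma one_sub_sq_mem_slitPlane {c : ℂ} (hc : ‖c‖ < 1) : 1 - c ^ 2 ∈ Complex.slitPlane :=
  Or.inl (one_sub_sq_re_pos hc)

lemma hillRoot_sq (c : ℂ) : hillRoot c ^ 2 = 1 - c ^ 2 := by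
  have := Complex.cpow_nat_inv_pow (1 - c ^ 2) (n := 2) two_ne_zero
  rw [hillRoot, one_div]
  exact_mod_cast this

lemma hillRoot_re_pos {c : ℂ} (hc : ‖c‖ < 1) : 0 < (hillRoot c).re := by
  have h0 : 1 - c ^ 2 ≠ 0 := Complex.slitPlane_ne_zero (one_sub_sq_mem_slitPlane hc)
  have harg := Complex.abs_arg_lt_pi_div_two_iff.2 (Or.inl (one_sub_sq_re_pos hc))
  rw [hillRoot, Complex.cpow_def_of_ne_zero h0, Complex.exp_re]
  refine mul_pos (Real.exp_pos _) (Real.cos_pos_of_mem_Ioo ?_)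
  have him : (Complex.log (1 - c ^ 2) * (1 / 2)).im = (1 - c ^ 2).arg / 2 := by
    rw [show (1 / 2 : ℂ) = ((1 / 2 : ℝ) : ℂ) by push_cast; ring, Complex.im_mul_ofReal,
      Complex.log_im]
    ring
  rw [him]
  have := abs_lt.1 harg
  constructor <;> linarith [Real.pi_pos]

lemma hillRoot_ne_zero {c : ℂ} (hc : ‖c‖ < 1) : hillRoot c ≠ 0 := fun h => by
  have := hillRoot_re_pos hc
  simp [h] at this

lemma differentiableAt_hillRoot {c : ℂ} (hc : ‖c‖ < 1) : DifferentiableAt ℂ hillRoot c := by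
  unfold hillRoot
  exact DifferentiableAt.cpow (by fun_prop) (by fun_prop) (one_sub_sq_mem_slitPlane hc)

lemma differentiableAt_hillAmp {c : ℂ} (hc : ‖c‖ < 1) : DifferentiableAt ℂ hillAmp c :=
  ((differentiableAt_const _).mul differentiableAt_id).div (differentiableAt_hillRoot hc)
    (hillRoot_ne_zero hc)

lemma differentiableAt_hillRatio {c : ℂ} (hc : ‖c‖ < 1) : DifferentiableAt ℂ hillRatio c :=
  ((differentiableAt_const _).mul differentiableAt_id).add (differentiableAt_hillRoot hc)

@[simp] lemma hillRoot_zero : hillRoot 0 = 1 := by simp [hillRoot]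
@[simp] lemma hillAmp_zero : hillAmp 0 = 0 := by simp [hillAmp]

lemma hasStrictDerivAt_hillAmp_zero : HasStrictDerivAt hillAmp Complex.I 0 := by
  have hr : HasStrictDerivAt hillRoot 0 0 := by
    have h1 : HasStrictDerivAt (fun c : ℂ => 1 - c ^ 2) 0 0 := by
      simpa using ((hasStrictDerivAt_id (0 : ℂ)).pow 2).const_sub 1
    have := h1.cpow (hasStrictDerivAt_const (0 : ℂ) (1 / 2 : ℂ)) (by simp)
    have h3 : HasStrictDerivAt hillRoot _ 0 := this
    simpa using h3
  have h2 : HasStrictDerivAt (fun c : ℂ => Complex.I * c) Complex.I 0 := by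
    simpa using (hasStrictDerivAt_id (0 : ℂ)).const_mul Complex.I
  have h3 : HasStrictDerivAt hillAmp _ 0 := h2.div hr (by simp)
  simpa using h3

/-- Since `1 / √(1 - c²) - 1 = O(c²)`, the amplitude is `i c` up to higher order. -/
lemma norm_hillAmp_sub_le {c : ℂ} (hc : ‖c‖ ≤ 1 / 2) :
    ‖hillAmp c - Complex.I * c‖ ≤ 2 * ‖c‖ ^ 3 := by
  have hc1 : ‖c‖ < 1 := by linarith
  set s := hillRoot c with hs
  have hs0 : s ≠ 0 := hillRoot_ne_zero hc1
  have hre : 0 < s.re := hillRoot_re_pos hc1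
  have h1s : 1 ≤ ‖1 + s‖ := by
    have := Complex.re_le_norm (1 + s)
    simp only [Complex.add_re, Complex.one_re] at this
    linarith
  have h1s0 : 1 + s ≠ 0 := norm_pos_iff.1 (by linarith)
  have hsn : 1 / 2 ≤ ‖s‖ := by
    have h2 : ‖s‖ ^ 2 = ‖1 - c ^ 2‖ := by rw [← norm_pow, hillRoot_sq]
    have h3 : 1 - ‖c‖ ^ 2 ≤ ‖1 - c ^ 2‖ := by
      have := norm_sub_norm_le (1 : ℂ) (c ^ 2)
      simpa using this
    nlinarith [norm_nonneg c, norm_nonneg s]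
  have hkey : hillAmp c - Complex.I * c = Complex.I * c ^ 3 / (s * (1 + s)) := by
    have := hillRoot_sq c
    rw [← hs] at this
    rw [hillAmp, ← hs]
    field_simp
    linear_combination -c * this
  rw [hkey, norm_div, norm_mul, norm_mul, norm_pow, Complex.norm_I, one_mul,
    div_le_iff₀ (by positivity)]
  have : 1 / 2 ≤ ‖s‖ * ‖1 + s‖ := by nlinarith
  nlinarith [pow_nonneg (norm_nonneg c) 3]

lemma hillRatio_mul (c : ℂ) : hillRatio c * (hillRoot c - Complex.I * c) = 1 := by
  have := hillRoot_sq c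
  rw [hillRatio]
  linear_combination this - c ^ 2 * Complex.I_sq

lemma norm_hillRatio_lt_one {c : ℂ} (hc : ‖c‖ < 1) (him : 0 < c.im) : ‖hillRatio c‖ < 1 := by
  have hmul := hillRatio_mul c
  have hsq := hillRoot_sq c
  have hre := hillRoot_re_pos hc
  set s := hillRoot c with hs
  -- `2 Re s Im s = -2 Re c Im c`, so `Im (s c̄) = -(Re c)² Im c / Re s - Re s Im c < 0`
  have h1 : s.re * s.im = -(c.re * c.im) := by
    have := congrArg Complex.im hsq
    simp [sq] at this
    linarith
  have h2 : s.im * c.re - s.re * c.im < 0 := by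
    have : s.re * (s.im * c.re - s.re * c.im) < 0 := by
      have : s.re * (s.im * c.re - s.re * c.im) = -(c.im * (c.re ^ 2 + s.re ^ 2)) := by
        linear_combination c.re * h1
      rw [this]
      have : 0 < c.im * (c.re ^ 2 + s.re ^ 2) := by positivity
      linarith
    by_contra hcon
    push Not at hcon
    nlinarith [mul_nonneg hre.le hcon]
  have h3 : Complex.normSq (hillRatio c) < Complex.normSq (s - Complex.I * c) := by
    rw [hillRatio, ← hs, Complex.normSq_apply, Complex.normSq_apply]
    simp
    nlinarith
  have h4 : ‖hillRatio c‖ < ‖s - Complex.I * c‖ := by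
    rw [Complex.normSq_eq_norm_sq, Complex.normSq_eq_norm_sq] at h3
    exact lt_of_pow_lt_pow_left₀ 2 (norm_nonneg _) h3
  have h5 : ‖hillRatio c‖ * ‖s - Complex.I * c‖ = 1 := by rw [← norm_mul, hmul, norm_one]
  nlinarith [norm_nonneg (hillRatio c)]

lemma norm_twoSidedPow (w : ℂ) (k : ℤ) : ‖twoSidedPow w k‖ = ‖w‖ ^ k.natAbs := by
  unfold twoSidedPow
  split_ifs <;> simp

lemma differentiable_twoSidedPow (k : ℤ) : Differentiable ℂ (fun w => twoSidedPow w k) := by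
  unfold twoSidedPow
  split_ifs <;> fun_prop

lemma summable_norm_twoSidedPow {w : ℂ} (hw : ‖w‖ < 1) :
    Summable fun k : ℤ => ‖twoSidedPow w k‖ := by
  have h := summable_geometric_of_lt_one (norm_nonneg w) hw
  simp only [norm_twoSidedPow]
  refine Summable.of_nat_of_neg ?_ ?_ <;> simpa using h

/-- The two geometric series on the unit circle which make up the Laurent series of
`z ↦ (1 - w z)⁻¹ - w / (z + w)`. -/
lemma hasSum_twoSidedPow_mul_exp {w z : ℂ} (hw : ‖w‖ < 1) {η : ℝ}
    (hz : z = Complex.exp (Complex.I * (η : ℂ))) :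
    HasSum (fun j : ℤ => twoSidedPow w j * Complex.exp (Complex.I * (j : ℂ) * (η : ℂ)))
      ((1 - w * z)⁻¹ + -(w / z) * (1 - -(w / z))⁻¹) := by
  have hzn : ‖z‖ = 1 := by
    rw [hz, mul_comm, Complex.norm_exp_ofReal_mul_I]
  have hexp : ∀ n : ℕ, Complex.exp (Complex.I * n * η) = z ^ n :=
    fun n => by rw [hz, ← Complex.exp_nat_mul]; congr 1; ring
  have hpos : HasSum (fun n : ℕ => (w * z) ^ n) (1 - w * z)⁻¹ :=
    hasSum_geometric_of_norm_lt_one (by rw [norm_mul, hzn]; linarith)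
  have hq : ‖-(w / z)‖ < 1 := by rw [norm_neg, norm_div, hzn, div_one]; exact hw
  have hneg := (hasSum_geometric_of_norm_lt_one hq).mul_left (-(w / z))
  have hpos' : ∀ n : ℕ, twoSidedPow w n * Complex.exp (Complex.I * ((n : ℤ) : ℂ) * η) =
      (w * z) ^ n := fun n => by
    rw [Int.cast_natCast, hexp, mul_pow, twoSidedPow, if_pos (Int.natCast_nonneg n),
      Int.natAbs_natCast]
  have hneg' : ∀ n : ℕ, twoSidedPow w (-((n : ℤ) + 1)) *
      Complex.exp (Complex.I * ((-((n : ℤ) + 1) : ℤ) : ℂ) * η) =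
      -(w / z) * (-(w / z)) ^ n := fun n => by
    have h3 : (-((n : ℤ) + 1)).natAbs = n + 1 := by omega
    have h4 : ¬ (0 ≤ -((n : ℤ) + 1)) := by omega
    have h5 : Complex.exp (Complex.I * ((-((n : ℤ) + 1) : ℤ) : ℂ) * η) = (z ^ (n + 1))⁻¹ := by
      rw [← hexp, ← Complex.exp_neg]; congr 1; push_cast; ring
    rw [twoSidedPow, if_neg h4, h3, h5, ← pow_succ', ← neg_div, div_pow, div_eq_mul_inv]
  exact HasSum.of_nat_of_neg_add_one
    (f := fun j : ℤ => twoSidedPow w j * Complex.exp (Complex.I * (j : ℂ) * η))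
    (hpos.congr_fun hpos') (hneg.congr_fun hneg')

/-- With `z = exp (i η)` and `2 i c = w - 1 / w` one has
`2 i w z (c + sin η) = (w + z) (w z - 1)`. -/
lemma add_sin_factor {c w : ℂ} (h : 2 * Complex.I * w * c = w ^ 2 - 1) (η : ℝ) :
    2 * Complex.I * w * Complex.exp (Complex.I * η) * (c + (Real.sin η : ℂ)) =
      (Complex.exp (Complex.I * η) + w) * (w * Complex.exp (Complex.I * η) - 1) := by
  have hz0 : Complex.exp (Complex.I * η) ≠ 0 := Complex.exp_ne_zero _
  have hsin : (Real.sin η : ℂ) =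
      ((Complex.exp (Complex.I * η))⁻¹ - Complex.exp (Complex.I * η)) * Complex.I / 2 := by
    rw [Complex.ofReal_sin, Complex.sin, ← Complex.exp_neg]
    congr 4 <;> ring_nf
  rw [hsin]
  generalize Complex.exp (Complex.I * η) = z at hz0
  linear_combination z * h + w * z * (z⁻¹ - z) * Complex.I_sq - w * mul_inv_cancel₀ hz0

/-- The Laurent expansion of `1 / (c + sin η)` on the unit circle, up to the factor
`-i / √(1 - c²)`. -/
lemma hasSum_twoSidedPow_hillRatio {c : ℂ} (hc : ‖c‖ < 1) (him : 0 < c.im) (η : ℝ) :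
    c + (Real.sin η : ℂ) ≠ 0 ∧
    HasSum (fun j : ℤ => twoSidedPow (hillRatio c) j * Complex.exp (Complex.I * j * η))
      (Complex.I * hillRoot c / (c + (Real.sin η : ℂ))) := by
  have hw := norm_hillRatio_lt_one hc him
  have hmul := hillRatio_mul c
  have hwdef : hillRatio c = Complex.I * c + hillRoot c := rfl
  have hsum := hasSum_twoSidedPow_mul_exp hw (η := η) rfl
  have hzn : ‖Complex.exp (Complex.I * η)‖ = 1 := by
    rw [mul_comm, Complex.norm_exp_ofReal_mul_I]
  have hfac := add_sin_factor (c := c) (w := hillRatio c)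
    (by linear_combination (-hillRatio c) * hwdef - hmul) η
  have h2s : 2 * hillRoot c * hillRatio c = hillRatio c ^ 2 + 1 := by
    linear_combination (-hillRatio c) * hwdef + hmul
  have hw0 : hillRatio c ≠ 0 := left_ne_zero_of_mul_eq_one hmul
  generalize (fun j : ℤ => twoSidedPow (hillRatio c) j * Complex.exp (Complex.I * j * η)) = f
    at hsum ⊢
  generalize hillRatio c = w at *
  generalize Complex.exp (Complex.I * η) = z at *
  generalize hillRoot c = s at *
  generalize c + (Real.sin η : ℂ) = q at *
  have hz0 : z ≠ 0 := norm_ne_zero_iff.1 (by rw [hzn]; exact one_ne_zero)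
  have h1 : 1 - w * z ≠ 0 := fun h => by
    have h' := congrArg norm (sub_eq_zero.1 h).symm
    rw [norm_mul, hzn, norm_one] at h'
    linarith
  have h2 : z + w ≠ 0 := fun h => by
    rw [eq_neg_of_add_eq_zero_left h, norm_neg] at hzn
    linarith
  have hne : q ≠ 0 := by
    intro h
    rw [h, mul_zero] at hfac
    rcases mul_eq_zero.1 hfac.symm with h | h
    · exact h2 h
    · exact h1 (by linear_combination -h)
  refine ⟨hne, ?_⟩
  have h3 : 1 - -(w / z) = (z + w) / z := by field_simp; ring
  rw [h3] at hsum
  convert hsum using 1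
  rw [div_eq_iff hne]
  have h4 : q = (z + w) * (w * z - 1) / (2 * Complex.I * w * z) := by
    rw [← hfac]; field_simp
  rw [h4]
  field_simp
  rw [Complex.I_sq]
  linear_combination z * (w * z - 1) * h2s

lemma integral_exp_int_mul (k : ℤ) :
    ∫ η in (0 : ℝ)..(2 * Real.pi), Complex.exp (Complex.I * k * η) =
      if k = 0 then 2 * (Real.pi : ℂ) else 0 := by
  split_ifs with hk
  · simp [hk]
  · rw [integral_exp_mul_complex (mul_ne_zero Complex.I_ne_zero (by exact_mod_cast hk))]
    rw [show Complex.I * (k : ℂ) * ((2 * Real.pi : ℝ) : ℂ) = k * (2 * Real.pi * Complex.I) by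
      push_cast; ring, Complex.exp_int_mul_two_pi_mul_I]
    simp

/-- The Fourier coefficients of an absolutely convergent trigonometric series. -/
lemma integral_hasSum_mul_exp {b : ℤ → ℂ} (hb : Summable fun k => ‖b k‖) {f : ℝ → ℂ}
    (hf : ∀ η : ℝ, HasSum (fun j : ℤ => b j * Complex.exp (Complex.I * j * η)) (f η)) (k : ℤ) :
    ∫ η in (0 : ℝ)..(2 * Real.pi), f η * Complex.exp (-(Complex.I * (k : ℂ) * (η : ℂ))) =
      2 * (Real.pi : ℂ) * b k := by
  have hn : ∀ (j : ℤ) (η : ℝ), ‖Complex.exp (Complex.I * j * η)‖ = 1 := fun j η => by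
    rw [show Complex.I * (j : ℂ) * η = ((j * η : ℝ) : ℂ) * Complex.I by push_cast; ring,
      Complex.norm_exp_ofReal_mul_I]
  have hmul : ∀ (j : ℤ) (η : ℝ), b j * Complex.exp (Complex.I * j * η) *
      Complex.exp (-(Complex.I * (k : ℂ) * (η : ℂ))) =
      b j * Complex.exp (Complex.I * ((j - k : ℤ) : ℂ) * η) := fun j η => by
    rw [mul_assoc, ← Complex.exp_add]; congr 2; push_cast; ring
  have h := intervalIntegral.hasSum_integral_of_dominated_convergence (μ := MeasureTheory.volume)
    (a := 0) (b := 2 * Real.pi)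
    (F := fun (j : ℤ) (η : ℝ) => b j * Complex.exp (Complex.I * ((j - k : ℤ) : ℂ) * η))
    (f := fun η : ℝ => f η * Complex.exp (-(Complex.I * (k : ℂ) * (η : ℂ))))
    (fun j _ => ‖b j‖) (fun j => by
      apply Continuous.aestronglyMeasurable; fun_prop)
    (fun j => Eventually.of_forall fun η _ => by rw [norm_mul, hn, mul_one])
    (Eventually.of_forall fun η _ => hb) intervalIntegrable_const
    (Eventually.of_forall fun η _ => by
      have := (hf η).mul_right (Complex.exp (-(Complex.I * (k : ℂ) * (η : ℂ))))
      exact this.congr_fun fun j => (hmul j η).symm)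
  have h2 : ∀ j : ℤ, (∫ η in (0 : ℝ)..(2 * Real.pi),
      b j * Complex.exp (Complex.I * ((j - k : ℤ) : ℂ) * η)) =
      if j = k then 2 * (Real.pi : ℂ) * b k else 0 := fun j => by
    rw [intervalIntegral.integral_const_mul, integral_exp_int_mul]
    by_cases hjk : j = k
    · simp [hjk, mul_comm]
    · simp [hjk, sub_eq_zero]
  exact h.unique ((hasSum_ite_eq k _).congr_fun h2)

/-- The Fourier coefficients in the upper half-plane: `g_k = δ_{k,0} + a w^k` for `k ≥ 0` and
`g_k = a (-w)^|k|` for `k < 0`. -/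
lemma hillCoeff_of_im_pos {c : ℂ} (hc : ‖c‖ < 1) (him : 0 < c.im) (k : ℤ) :
    hillCoeff c k = (if k = 0 then 1 else 0) + hillAmp c * twoSidedPow (hillRatio c) k := by
  have hs0 := hillRoot_ne_zero hc
  have hb := summable_norm_twoSidedPow (norm_hillRatio_lt_one hc him)
  have hsum : ∀ η : ℝ, HasSum (fun j : ℤ => ((if j = 0 then 1 else 0) +
      hillAmp c * twoSidedPow (hillRatio c) j) * Complex.exp (Complex.I * j * η))
      (hillPotential c η) := fun η => by
    obtain ⟨hne, h⟩ := hasSum_twoSidedPow_hillRatio hc him η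
    have h1 := (hasSum_ite_eq (0 : ℤ) (1 : ℂ)).add (h.mul_left (hillAmp c))
    have h2 : hillPotential c η =
        1 + hillAmp c * (Complex.I * hillRoot c / (c + (Real.sin η : ℂ))) := by
      rw [hillPotential, hillAmp]
      field_simp
      linear_combination -c * Complex.I_sq
    rw [h2]
    refine h1.congr_fun fun j => ?_
    by_cases hj : j = 0
    · simp [hj]
    · simp [hj]; ring
  rw [hillCoeff, integral_hasSum_mul_exp (b := fun j : ℤ => (if j = 0 then 1 else 0) +
      hillAmp c * twoSidedPow (hillRatio c) j) ?_ hsum]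
  · have := Real.pi_ne_zero
    field_simp
  · refine Summable.of_nonneg_of_le (fun _ => norm_nonneg _) (fun j => norm_add_le _ _) ?_
    refine Summable.add ?_ ?_
    · refine summable_of_ne_finset_zero (s := {0}) fun j hj => ?_
      simp at hj
      simp [hj]
    · simpa only [norm_mul] using hb.mul_left ‖hillAmp c‖

/-- At `c = 0` the potential is almost everywhere equal to `1`. -/
lemma hillCoeff_zero (k : ℤ) : hillCoeff 0 k = if k = 0 then 1 else 0 := by
  have hcount : {η : ℝ | Real.sin η = 0}.Countable := by
    refine (Set.countable_range (fun n : ℤ => (n : ℝ) * Real.pi)).mono fun η hη => ?_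
    exact Real.sin_eq_zero_iff.1 hη
  have hae : ∀ᵐ η : ℝ, Real.sin η ≠ 0 := by
    rw [MeasureTheory.ae_iff]
    simpa using hcount.measure_zero MeasureTheory.volume
  have hint : ∫ η in (0 : ℝ)..(2 * Real.pi),
      hillPotential 0 η * Complex.exp (-(Complex.I * (k : ℂ) * (η : ℂ))) =
      ∫ η in (0 : ℝ)..(2 * Real.pi), Complex.exp (Complex.I * ((-k : ℤ) : ℂ) * η) := by
    refine intervalIntegral.integral_congr_ae ?_
    filter_upwards [hae] with η hη _
    have : (Real.sin η : ℂ) ≠ 0 := by exact_mod_cast hη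
    rw [hillPotential, zero_add, div_self this, one_mul]
    congr 1; push_cast; ring
  rw [hillCoeff, hint, integral_exp_int_mul]
  by_cases hk : k = 0
  · have : (Real.pi : ℂ) ≠ 0 := by exact_mod_cast Real.pi_ne_zero
    simp only [hk, neg_zero, if_true]
    field_simp
  · simp [hk]

/-- The substitution `η ↦ -η` exchanges `c` and `-c`. -/
lemma hillCoeff_neg (c : ℂ) (k : ℤ) : hillCoeff (-c) k = hillCoeff c (-k) := by
  set f : ℝ → ℂ := fun η =>
    hillPotential c η * Complex.exp (-(Complex.I * ((-k : ℤ) : ℂ) * (η : ℂ))) with hf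
  have hper : Function.Periodic f (2 * Real.pi) := fun η => by
    have h1 : Complex.exp (-(Complex.I * ((-k : ℤ) : ℂ) * ((η + 2 * Real.pi : ℝ) : ℂ))) =
        Complex.exp (-(Complex.I * ((-k : ℤ) : ℂ) * (η : ℂ))) := by
      rw [show -(Complex.I * ((-k : ℤ) : ℂ) * ((η + 2 * Real.pi : ℝ) : ℂ)) =
        -(Complex.I * ((-k : ℤ) : ℂ) * (η : ℂ)) + k * (2 * Real.pi * Complex.I) by
          push_cast; ring, Complex.exp_add, Complex.exp_int_mul_two_pi_mul_I, mul_one]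
    simp only [hf, h1, hillPotential, Real.sin_add_two_pi]
  have h1 : ∀ η : ℝ, hillPotential (-c) η * Complex.exp (-(Complex.I * (k : ℂ) * (η : ℂ))) =
      f (-η) := fun η => by
    simp only [hf, hillPotential, Real.sin_neg]
    congr 1
    · rw [Complex.ofReal_neg, ← neg_div_neg_eq, neg_add, neg_neg]
    · congr 1; push_cast; ring
  rw [hillCoeff, hillCoeff]
  congr 1
  simp only [h1]
  rw [intervalIntegral.integral_comp_neg]
  have := hper.intervalIntegral_add_eq (-(2 * Real.pi)) 0
  rw [neg_add_cancel, zero_add] at this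
  rw [neg_zero, this]

lemma conj_hillCoeff (c : ℂ) (k : ℤ) :
    (starRingEnd ℂ) (hillCoeff c k) = hillCoeff (-(starRingEnd ℂ) c) k := by
  rw [hillCoeff_neg, hillCoeff, hillCoeff, map_mul, ← intervalIntegral.intervalIntegral_conj]
  congr 1
  · simp [Complex.conj_ofNat]
  · refine intervalIntegral.integral_congr fun η _ => ?_
    simp only [hillPotential, map_mul, map_div₀, map_add, Complex.conj_ofReal, ← Complex.exp_conj,
      map_neg, Complex.conj_I, map_intCast]
    congr 2; push_cast; ring

/-- On the imaginary axis the Fourier coefficients are real. -/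
lemma conj_hillCoeff_I_mul (y : ℝ) (k : ℤ) :
    (starRingEnd ℂ) (hillCoeff (Complex.I * y) k) = hillCoeff (Complex.I * y) k := by
  rw [conj_hillCoeff]
  simp

/-! ### Principal minors of small perturbations of the identity -/

/-- The principal minor of the infinite matrix `M` with index set `S`. -/
def principalMinor {ι : Type*} [DecidableEq ι] (M : ι → ι → ℂ) (S : Finset ι) : ℂ :=
  Matrix.det (Matrix.of fun n m : ↥S => M n m)

/-- The matrix `M` has unit diagonal, and its off-diagonal entries in row `n` are at most `q r_n`,
where the sum of `r` is at most `R` and `q R ≤ 1 / 2`. -/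
structure RowBounded {ι : Type*} (M : ι → ι → ℂ) (r : ι → ℝ) (q R : ℝ) : Prop where
  diag : ∀ n, M n n = 1
  offDiag : ∀ n m, n ≠ m → ‖M n m‖ ≤ q * r n
  r_nonneg : ∀ n, 0 ≤ r n
  q_nonneg : 0 ≤ q
  sum_le : ∀ S : Finset ι, ∑ n ∈ S, r n ≤ R
  mul_le : q * R ≤ 1 / 2

namespace RowBounded

variable {ι : Type*} {M : ι → ι → ℂ} {r : ι → ℝ} {q R : ℝ}

lemma R_nonneg (h : RowBounded M r q R) : 0 ≤ R := by simpa using h.sum_le ∅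

variable [DecidableEq ι]

/-- Solutions of a linear system with matrix `M` inherit the decay `q r_n` of the right-hand side:
summing the row estimates `‖x_n‖ ≤ q r_n (β + ∑ ‖x_m‖)` bounds `∑ ‖x_m‖` by `β`, as
`q R ≤ 1 / 2`. -/
lemma norm_le_of_mulVec (h : RowBounded M r q R) (S : Finset ι) {x b : ↥S → ℂ}
    (hx : (Matrix.of fun n m : ↥S => M n m).mulVec x = b) {β : ℝ} (hβ : 0 ≤ β)
    (hb : ∀ n, ‖b n‖ ≤ β * (q * r n)) (n : ↥S) : ‖x n‖ ≤ 2 * β * (q * r n) := by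
  set T := ∑ m, ‖x m‖ with hT
  have hrow : ∀ n : ↥S, ‖x n‖ ≤ q * r n * (β + T) := fun n => by
    have h1 : x n = b n - ∑ m ∈ Finset.univ.erase n, M n m * x m := by
      rw [← hx, Matrix.mulVec, dotProduct, ← Finset.add_sum_erase _ _ (Finset.mem_univ n)]
      simp [h.diag]
    have h2 : ‖∑ m ∈ Finset.univ.erase n, M n m * x m‖ ≤ q * r n * T := by
      calc ‖∑ m ∈ Finset.univ.erase n, M n m * x m‖
          ≤ ∑ m ∈ Finset.univ.erase n, q * r n * ‖x m‖ := by
            refine norm_sum_le_of_le _ fun m hm => ?_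
            rw [norm_mul]
            refine mul_le_mul_of_nonneg_right (h.offDiag _ _ ?_) (norm_nonneg _)
            exact fun hnm => (Finset.ne_of_mem_erase hm) (Subtype.ext hnm.symm)
        _ ≤ ∑ m, q * r n * ‖x m‖ :=
            Finset.sum_le_sum_of_subset_of_nonneg (Finset.erase_subset _ _) fun m _ _ =>
              mul_nonneg (mul_nonneg h.q_nonneg (h.r_nonneg _)) (norm_nonneg _)
        _ = q * r n * T := by rw [hT, Finset.mul_sum]
    rw [h1]
    have := norm_sub_le (b n) (∑ m ∈ Finset.univ.erase n, M n m * x m)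
    linarith [hb n]
  have hT0 : 0 ≤ T := Finset.sum_nonneg fun _ _ => norm_nonneg _
  have hTle : T ≤ β := by
    have h1 : T ≤ q * R * (β + T) := by
      calc T ≤ ∑ n : ↥S, q * r n * (β + T) := Finset.sum_le_sum fun n _ => hrow n
        _ = q * (∑ n ∈ S, r n) * (β + T) := by
            rw [← Finset.sum_mul, ← Finset.mul_sum, Finset.sum_coe_sort S r]
        _ ≤ q * R * (β + T) :=
            mul_le_mul_of_nonneg_right (mul_le_mul_of_nonneg_left (h.sum_le S) h.q_nonneg)
              (by linarith)
    have h2 : q * R * (β + T) ≤ 1 / 2 * (β + T) :=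
      mul_le_mul_of_nonneg_right h.mul_le (by linarith)
    linarith
  have h3 : 0 ≤ q * r n := mul_nonneg h.q_nonneg (h.r_nonneg _)
  nlinarith [hrow n]

lemma principalMinor_ne_zero (h : RowBounded M r q R) (S : Finset ι) :
    principalMinor M S ≠ 0 := by
  intro h0
  obtain ⟨x, hx0, hx⟩ := Matrix.exists_mulVec_eq_zero_iff.2 h0
  refine hx0 (funext fun n => ?_)
  have := h.norm_le_of_mulVec S hx le_rfl (fun n => by simp) n
  simpa using this

/-- Adjoining one index multiplies a principal minor by the Schur complement `1 - γ A⁻¹ β`, and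
`γ A⁻¹ β` is small. -/
lemma norm_principalMinor_insert_sub_le (h : RowBounded M r q R) {S : Finset ι} {j : ι}
    (hj : j ∉ S) : ‖principalMinor M (insert j S) - principalMinor M S‖ ≤
      ‖principalMinor M S‖ * (2 * q ^ 2 * R * r j) := by
  set A : Matrix ↥S ↥S ℂ := Matrix.of fun n m => M n m with hA
  set b : ↥S → ℂ := fun n => M n j with hb
  set γ : ↥S → ℂ := fun m => M j m with hγ
  have hdet : A.det ≠ 0 := h.principalMinor_ne_zero S
  let _ : Invertible A := Matrix.invertibleOfIsUnitDet A (isUnit_iff_ne_zero.2 hdet)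
  let e : ↥S ⊕ Unit ≃ ↥(insert j S) :=
    ((Finset.subtypeInsertEquivOption hj).trans (Equiv.optionEquivSumPUnit _)).symm
  have he1 : ∀ n : ↥S, ((e (Sum.inl n) : ↥(insert j S)) : ι) = n := fun n => rfl
  have he2 : ∀ u : Unit, ((e (Sum.inr u) : ↥(insert j S)) : ι) = j := fun u => rfl
  have hblock : (Matrix.of fun n m : ↥(insert j S) => M n m).submatrix e e =
      Matrix.fromBlocks A (Matrix.of fun n (_ : Unit) => b n) (Matrix.of fun (_ : Unit) m => γ m)
        1 := by
    ext n m
    rcases n with n | n <;> rcases m with m | m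
    · simp [he1, hA]
    · simp [he1, he2, hb]
    · simp [he1, he2, hγ]
    · simp [he2, h.diag]
  set x : ↥S → ℂ := (⅟A).mulVec b with hx
  have hAx : A.mulVec x = b := by
    rw [hx, Matrix.mulVec_mulVec, mul_invOf_self, Matrix.one_mulVec]
  have hxle := h.norm_le_of_mulVec S hAx zero_le_one
    (fun n => by
      rw [one_mul]
      exact h.offDiag _ _ fun hn => hj (hn ▸ n.2))
  have hD : principalMinor M (insert j S) = principalMinor M S * (1 - ∑ m, γ m * x m) := by
    rw [principalMinor, ← Matrix.det_submatrix_equiv_self e, hblock, Matrix.det_fromBlocks₁₁]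
    congr 1
    rw [Matrix.det_unique, Matrix.sub_apply, Matrix.mul_assoc, Matrix.mul_apply]
    simp [hx, Matrix.mulVec, Matrix.mul_apply, dotProduct]
  have hsum : ‖∑ m, γ m * x m‖ ≤ 2 * q ^ 2 * R * r j := by
    calc ‖∑ m, γ m * x m‖ ≤ ∑ m : ↥S, (q * r j) * (2 * 1 * (q * r m)) := by
          refine norm_sum_le_of_le _ fun m _ => ?_
          rw [norm_mul]
          exact mul_le_mul (h.offDiag _ _ fun hn => hj (hn ▸ m.2)) (hxle m) (norm_nonneg _)
            (mul_nonneg h.q_nonneg (h.r_nonneg _))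
      _ = 2 * q ^ 2 * r j * ∑ n ∈ S, r n := by
          rw [← Finset.mul_sum, ← Finset.mul_sum, ← Finset.mul_sum, Finset.sum_coe_sort S r]
          ring
      _ ≤ 2 * q ^ 2 * r j * R :=
          mul_le_mul_of_nonneg_left (h.sum_le S)
            (mul_nonneg (by positivity) (h.r_nonneg _))
      _ = 2 * q ^ 2 * R * r j := by ring
  rw [hD, mul_sub, mul_one, sub_sub_cancel_left, norm_neg, norm_mul]
  exact mul_le_mul_of_nonneg_left hsum (norm_nonneg _)

/-- Adjoining the finitely many indices of `T` multiplies a principal minor by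
`1 + O(∑_{j ∈ T} r_j)`. -/
lemma norm_principalMinor_union_sub_le (h : RowBounded M r q R) (S T : Finset ι)
    (hST : Disjoint S T) : ‖principalMinor M (S ∪ T) - principalMinor M S‖ ≤
      ‖principalMinor M S‖ * (Real.exp (2 * q ^ 2 * R * ∑ j ∈ T, r j) - 1) := by
  induction T using Finset.induction_on with
  | empty => simp
  | insert j T hjT ih =>
    rw [Finset.disjoint_insert_right] at hST
    have ih := ih hST.2
    have hj : j ∉ S ∪ T := by simp [hST.1, hjT]
    have h1 := h.norm_principalMinor_insert_sub_le hj
    rw [Finset.union_insert, Finset.sum_insert hjT, mul_add, Real.exp_add]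
    set u := 2 * q ^ 2 * R * r j with hu
    set E := Real.exp (2 * q ^ 2 * R * ∑ j ∈ T, r j) with hE
    set D := principalMinor M S
    set D' := principalMinor M (S ∪ T)
    have hu0 : 0 ≤ u :=
      mul_nonneg (mul_nonneg (by positivity) h.R_nonneg) (h.r_nonneg _)
    have hexp : u + 1 ≤ Real.exp u := Real.add_one_le_exp u
    have hD' : ‖D'‖ ≤ ‖D‖ * E := by
      have := norm_sub_norm_le D' D
      nlinarith
    have h2 : ‖principalMinor M (insert j (S ∪ T)) - D‖ ≤ ‖D'‖ * u + ‖D‖ * (E - 1) := by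
      have := norm_sub_le_norm_sub_add_norm_sub (principalMinor M (insert j (S ∪ T))) D' D
      linarith
    have h3 : ‖D'‖ * u ≤ ‖D‖ * E * (Real.exp u - 1) :=
      mul_le_mul hD' (by linarith) hu0 (mul_nonneg (norm_nonneg _) (Real.exp_pos _).le)
    linarith

lemma norm_principalMinor_sub_one_le (h : RowBounded M r q R) (S : Finset ι) :
    ‖principalMinor M S - 1‖ ≤ 4 * R ^ 2 * q ^ 2 := by
  have h0 := h.norm_principalMinor_union_sub_le ∅ S (by simp)
  have h1 : principalMinor M ∅ = 1 := by simp [principalMinor]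
  rw [h1, Finset.empty_union, norm_one, one_mul] at h0
  refine h0.trans ?_
  have hq := h.q_nonneg
  have hR := h.R_nonneg
  have h2 : 2 * q ^ 2 * R * ∑ j ∈ S, r j ≤ 2 * (q * R) ^ 2 := by
    calc 2 * q ^ 2 * R * ∑ j ∈ S, r j ≤ 2 * q ^ 2 * R * R :=
          mul_le_mul_of_nonneg_left (h.sum_le S) (by positivity)
      _ = 2 * (q * R) ^ 2 := by ring
  have h3 : 2 * (q * R) ^ 2 ≤ 1 := by nlinarith [h.mul_le, mul_nonneg hq hR]
  have h4 : Real.exp (2 * (q * R) ^ 2) - 1 ≤ 2 * (2 * (q * R) ^ 2) := by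
    have h5 := Real.abs_exp_sub_one_le (x := 2 * (q * R) ^ 2)
      (by rw [abs_of_nonneg (by positivity)]; exact h3)
    rw [abs_of_nonneg (show 0 ≤ 2 * (q * R) ^ 2 by positivity)] at h5
    exact (le_abs_self _).trans h5
  have := Real.exp_le_exp.2 h2
  nlinarith

end RowBounded

/-- The central truncations of a `RowBounded` matrix over `ℤ` converge. -/
lemma RowBounded.exists_tendsto {M : ℤ → ℤ → ℂ} {r : ℤ → ℝ} {q R : ℝ}
    (h : RowBounded M r q R) :
    ∃ D, Tendsto (fun N : ℕ => principalMinor M (Finset.Icc (-(N : ℤ)) N)) atTop (𝓝 D) := by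
  refine cauchySeq_tendsto_of_complete (cauchySeq_of_summable_dist ?_)
  have hsum : Summable r := summable_of_sum_le h.r_nonneg h.sum_le
  have hq := h.q_nonneg
  have hR := h.R_nonneg
  have hqR : 2 * q ^ 2 * R * R ≤ 1 := by nlinarith [h.mul_le, mul_nonneg hq hR]
  have hs1 : Summable fun N : ℕ => r ((N : ℤ) + 1) :=
    hsum.comp_injective (i := fun N : ℕ => (N : ℤ) + 1) fun a b hab => by simpa using hab
  have hs2 : Summable fun N : ℕ => r (-((N : ℤ) + 1)) :=
    hsum.comp_injective (i := fun N : ℕ => -((N : ℤ) + 1)) fun a b hab => by simpa using hab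
  refine Summable.of_nonneg_of_le (fun _ => dist_nonneg) (fun N => ?_)
    ((hs1.add hs2).mul_left (2 * (2 * (2 * q ^ 2 * R))))
  set S := Finset.Icc (-(N : ℤ)) N with hS
  set T : Finset ℤ := {(N : ℤ) + 1, -((N : ℤ) + 1)} with hT
  have hST : Disjoint S T := by
    rw [Finset.disjoint_left]
    intro a ha hb
    simp only [hS, hT, Finset.mem_Icc, Finset.mem_insert, Finset.mem_singleton] at ha hb
    omega
  have hU : Finset.Icc (-((N.succ : ℕ) : ℤ)) (N.succ : ℕ) = S ∪ T := by
    ext a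
    simp only [hS, hT, Finset.mem_Icc, Finset.mem_insert, Finset.mem_singleton, Finset.mem_union]
    push_cast
    omega
  have hTs : ∑ j ∈ T, r j = r ((N : ℤ) + 1) + r (-((N : ℤ) + 1)) := by
    rw [hT, Finset.sum_pair (by omega)]
  have h1 := h.norm_principalMinor_union_sub_le S T hST
  have h2 : ‖principalMinor M S‖ ≤ 2 := by
    have := h.norm_principalMinor_sub_one_le S
    have h3 := norm_sub_norm_le (principalMinor M S) 1
    rw [norm_one] at h3
    nlinarith [h.mul_le, mul_nonneg hq hR]
  rw [dist_comm, dist_eq_norm, hU, ← hTs]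
  have hT0 : 0 ≤ ∑ j ∈ T, r j := Finset.sum_nonneg fun j _ => h.r_nonneg j
  set t := 2 * q ^ 2 * R * ∑ j ∈ T, r j with ht
  have ht0 : 0 ≤ t := by positivity
  have ht1 : t ≤ 1 :=
    (mul_le_mul_of_nonneg_left (h.sum_le T) (by positivity)).trans hqR
  have h5 := Real.abs_exp_sub_one_le (x := t) (by rwa [abs_of_nonneg ht0])
  rw [abs_of_nonneg ht0] at h5
  have h6 := (le_abs_self _).trans h5
  have h7 : ‖principalMinor M S‖ * (Real.exp t - 1) ≤ 2 * (2 * t) :=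
    mul_le_mul h2 h6 (by linarith [Real.add_one_le_exp t]) (by norm_num)
  calc _ ≤ 2 * (2 * t) := h1.trans h7
    _ = _ := by rw [ht]; ring

/-! ### Hill's determinant near `c = 0` -/

/-- The part of the domain on which the closed form of the Fourier coefficients is used: the open
upper half-plane and the origin. -/
def upperPart : Set ℂ := {c : ℂ | 0 < c.im ∨ c = 0}

lemma hillCoeff_of_mem_upperPart {c : ℂ} (hc : ‖c‖ < 1) (hu : c ∈ upperPart) (k : ℤ) :
    hillCoeff c k = (if k = 0 then 1 else 0) + hillAmp c * twoSidedPow (hillRatio c) k := by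
  rcases hu with hu | rfl
  · exact hillCoeff_of_im_pos hc hu k
  · simp [hillCoeff_zero]

lemma hillCoeff_zero_index {c : ℂ} (hc : ‖c‖ < 1) (hu : c ∈ upperPart) :
    hillCoeff c 0 = 1 + hillAmp c := by
  simp [hillCoeff_of_mem_upperPart hc hu, twoSidedPow]

lemma norm_hillAmp_le {c : ℂ} (hc : ‖c‖ ≤ 1 / 2) : ‖hillAmp c‖ ≤ 2 * ‖c‖ := by
  have h1 := norm_hillAmp_sub_le hc
  have h2 := norm_sub_norm_le (hillAmp c) (Complex.I * c)
  rw [norm_mul, Complex.norm_I, one_mul] at h2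
  have h3 : 2 * ‖c‖ ^ 3 ≤ ‖c‖ := by
    have := norm_nonneg c
    have : ‖c‖ ^ 2 ≤ 1 / 4 := by nlinarith
    nlinarith
  linarith

lemma norm_hillCoeff_le {c : ℂ} (hc : ‖c‖ ≤ 1 / 2) (hu : c ∈ upperPart) {k : ℤ} (hk : k ≠ 0) :
    ‖hillCoeff c k‖ ≤ 2 * ‖c‖ := by
  rw [hillCoeff_of_mem_upperPart (by linarith) hu, if_neg hk, zero_add, norm_mul,
    norm_twoSidedPow]
  refine le_trans ?_ (norm_hillAmp_le hc)
  rcases hu with hu | rfl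
  · have hw := norm_hillRatio_lt_one (by linarith) hu
    exact mul_le_of_le_one_right (norm_nonneg _) (pow_le_one₀ (norm_nonneg _) hw.le)
  · simp

lemma summable_one_div_one_add_sq : Summable fun n : ℤ => 1 / (1 + (n : ℝ) ^ 2) := by
  refine Summable.of_norm_bounded_eventually (g := fun n : ℤ => 1 / (n : ℝ) ^ 2)
    (Real.summable_one_div_int_pow.2 one_lt_two) ?_
  refine (Set.finite_singleton (0 : ℤ)).subset fun n hn => ?_
  by_contra h0
  refine hn ?_
  have : (0 : ℝ) < (n : ℝ) ^ 2 := by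
    have : (n : ℝ) ≠ 0 := by exact_mod_cast h0
    positivity
  change ‖1 / (1 + (n : ℝ) ^ 2)‖ ≤ 1 / (n : ℝ) ^ 2
  rw [Real.norm_eq_abs, abs_of_nonneg (by positivity)]
  exact one_div_le_one_div_of_le this (by linarith)

/-- Between the squares `0` and `1`, the distance to `n²` grows like `1 + n²`. -/
lemma le_norm_sub_sq {α : ℝ} (hα : 0 < α) {Λ : ℂ} (h1 : α ≤ Λ.re) (h2 : Λ.re ≤ 1 - α) (n : ℤ) :
    α / 2 * (1 + (n : ℝ) ^ 2) ≤ ‖Λ - (n : ℂ) ^ 2‖ := by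
  have hre : (Λ - (n : ℂ) ^ 2).re = Λ.re - (n : ℝ) ^ 2 := by
    rw [Complex.sub_re]
    congr 1
    rw [← Complex.ofReal_intCast, ← Complex.ofReal_pow, Complex.ofReal_re]
  have h3 := Complex.abs_re_le_norm (Λ - (n : ℂ) ^ 2)
  rw [hre] at h3
  refine le_trans ?_ h3
  by_cases h0 : n = 0
  · subst h0
    have := le_abs_self Λ.re
    simp only [Int.cast_zero, ne_eq, OfNat.ofNat_ne_zero, not_false_eq_true, zero_pow, sub_zero,
      add_zero, mul_one]
    linarith
  · have h4 : (1 : ℝ) ≤ (n : ℝ) ^ 2 := by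
      have : 0 < n ^ 2 := by positivity
      have : 1 ≤ n ^ 2 := this
      exact_mod_cast this
    have := neg_le_abs (Λ.re - (n : ℝ) ^ 2)
    nlinarith

lemma ne_sq_of_re {α : ℝ} (hα : 0 < α) {Λ : ℂ} (h1 : α ≤ Λ.re) (h2 : Λ.re ≤ 1 - α) (n : ℤ) :
    Λ - (n : ℂ) ^ 2 ≠ 0 := by
  have := le_norm_sub_sq hα h1 h2 n
  exact norm_pos_iff.1 (lt_of_lt_of_le (by positivity) this)

lemma hillDetTrunc_eq_principalMinor (c Λ : ℂ) (N : ℕ) :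
    hillDetTrunc c Λ N = principalMinor (hillEntry c Λ) (Finset.Icc (-(N : ℤ)) N) := rfl

/-- Hill's matrix has small row-bounded off-diagonal part, so that Hill's determinant converges and
is `1 + O(c²)`, uniformly for `Λ` in a closed strip strictly between the squares `0` and `1`. -/
lemma exists_hillDet_bound {α : ℝ} (hα : 0 < α) :
    ∃ ε, 0 < ε ∧ ε ≤ 1 / 2 ∧ ∃ C, 0 ≤ C ∧ ∀ c Λ : ℂ, c ∈ upperPart → ‖c‖ < ε → α ≤ Λ.re →
      Λ.re ≤ 1 - α → (∀ N, ‖hillDetTrunc c Λ N - 1‖ ≤ C * ‖c‖ ^ 2) ∧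
        Tendsto (hillDetTrunc c Λ) atTop (𝓝 (hillDet c Λ)) := by
  set r : ℤ → ℝ := fun n => 2 / α * (1 / (1 + (n : ℝ) ^ 2)) with hr
  have hr0 : ∀ n, 0 ≤ r n := fun n => by positivity
  have hrs : Summable r := summable_one_div_one_add_sq.mul_left _
  set R := ∑' n, r n with hR
  have hR0 : 0 ≤ R := tsum_nonneg hr0
  refine ⟨1 / (4 * R + 2), by positivity, ?_, 16 * R ^ 2, by positivity, ?_⟩
  · exact one_div_le_one_div_of_le (by norm_num) (by linarith)
  intro c Λ hu hc h1 h2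
  have hcR : ‖c‖ * (4 * R + 2) < 1 := by rwa [lt_div_iff₀ (by positivity)] at hc
  have hc2 : ‖c‖ ≤ 1 / 2 := by nlinarith [norm_nonneg c]
  have hb : RowBounded (hillEntry c Λ) r (2 * ‖c‖) R :=
    { diag := fun n => if_pos rfl
      offDiag := fun n m hnm => by
        rw [hillEntry, if_neg hnm, norm_div, hr]
        have h3 := le_norm_sub_sq hα h1 h2 n
        have h4 : 0 < α / 2 * (1 + (n : ℝ) ^ 2) := by positivity
        calc ‖hillCoeff c (n - m)‖ / ‖Λ - (n : ℂ) ^ 2‖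
            ≤ 2 * ‖c‖ / (α / 2 * (1 + (n : ℝ) ^ 2)) :=
              div_le_div₀ (by positivity) (norm_hillCoeff_le hc2 hu (sub_ne_zero.2 hnm)) h4 h3
          _ = _ := by field_simp
      r_nonneg := hr0
      q_nonneg := by positivity
      sum_le := fun S => hrs.sum_le_tsum S fun n _ => hr0 n
      mul_le := by nlinarith [norm_nonneg c] }
  refine ⟨fun N => ?_, ?_⟩
  · rw [hillDetTrunc_eq_principalMinor]
    refine (hb.norm_principalMinor_sub_one_le _).trans (le_of_eq (by ring))
  · exact tendsto_nhds_limUnder hb.exists_tendsto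

lemma hillDetTrunc_neg (c Λ : ℂ) (N : ℕ) : hillDetTrunc (-c) Λ N = hillDetTrunc c Λ N := by
  let e : ↥(Finset.Icc (-(N : ℤ)) (N : ℤ)) ≃ ↥(Finset.Icc (-(N : ℤ)) (N : ℤ)) :=
    { toFun := fun n => ⟨-n, by have := n.2; rw [Finset.mem_Icc] at this ⊢; omega⟩
      invFun := fun n => ⟨-n, by have := n.2; rw [Finset.mem_Icc] at this ⊢; omega⟩
      left_inv := fun n => by simp
      right_inv := fun n => by simp }
  rw [hillDetTrunc, hillDetTrunc, ← Matrix.det_submatrix_equiv_self e]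
  congr 1
  ext n m
  have h1 : ((e n : ↥(Finset.Icc (-(N : ℤ)) (N : ℤ))) : ℤ) = -n := rfl
  have h2 : ((e m : ↥(Finset.Icc (-(N : ℤ)) (N : ℤ))) : ℤ) = -m := rfl
  simp only [Matrix.submatrix_apply, Matrix.of_apply, h1, h2, hillEntry, hillCoeff_neg, neg_inj]
  congr 2
  · congr 1; ring
  · push_cast; ring

lemma hillDet_neg (c Λ : ℂ) : hillDet (-c) Λ = hillDet c Λ := by
  have : hillDetTrunc (-c) Λ = hillDetTrunc c Λ := funext fun N => hillDetTrunc_neg c Λ N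
  rw [hillDet, hillDet, this]

lemma evansE_neg (c : ℂ) (θ d : ℝ) : evansE (-c) θ d = evansE c θ d := by
  simp only [evansE, hillDet_neg, hillCoeff_neg, neg_zero]

lemma conj_hillDetTrunc_I_mul (y Λ : ℝ) (N : ℕ) :
    (starRingEnd ℂ) (hillDetTrunc (Complex.I * y) Λ N) = hillDetTrunc (Complex.I * y) Λ N := by
  rw [hillDetTrunc, RingHom.map_det]
  congr 1
  ext n m
  simp only [RingHom.mapMatrix_apply, Matrix.map_apply, Matrix.of_apply, hillEntry]
  split_ifs
  · simp
  · rw [map_div₀, conj_hillCoeff_I_mul]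
    simp

lemma differentiableAt_hillDetTrunc {γ L : ℂ → ℂ} {z : ℂ} (N : ℕ)
    (hg : ∀ k : ℤ, k ≠ 0 → DifferentiableAt ℂ (fun z => hillCoeff (γ z) k) z)
    (hL : DifferentiableAt ℂ L z) (hne : ∀ n : ℤ, L z - (n : ℂ) ^ 2 ≠ 0) :
    DifferentiableAt ℂ (fun z => hillDetTrunc (γ z) (L z) N) z := by
  simp only [hillDetTrunc, Matrix.det_apply, Matrix.of_apply]
  refine DifferentiableAt.fun_sum fun σ _ => DifferentiableAt.const_smul ?_ _
  refine DifferentiableAt.fun_finsetProd fun i _ => ?_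
  simp only [hillEntry]
  split_ifs with h
  · exact differentiableAt_const _
  · exact (hg _ (sub_ne_zero.2 h)).div (hL.sub_const _) (hne _)

lemma differentiableAt_hillCoeff {c : ℂ} (hc : ‖c‖ < 1) (him : 0 < c.im) (k : ℤ) :
    DifferentiableAt ℂ (fun z => hillCoeff z k) c := by
  have hev : (fun z => hillCoeff z k) =ᶠ[𝓝 c] fun z =>
      (if k = 0 then 1 else 0) + hillAmp z * twoSidedPow (hillRatio z) k := by
    have h1 : ∀ᶠ z : ℂ in 𝓝 c, ‖z‖ < 1 := (continuous_norm.tendsto c).eventually (gt_mem_nhds hc)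
    have h2 : ∀ᶠ z : ℂ in 𝓝 c, 0 < z.im :=
      (Complex.continuous_im.tendsto c).eventually (lt_mem_nhds him)
    filter_upwards [h1, h2] with z hz1 hz2 using hillCoeff_of_im_pos hz1 hz2 k
  refine DifferentiableAt.congr_of_eventuallyEq ?_ hev
  refine (differentiableAt_const _).add ((differentiableAt_hillAmp hc).mul ?_)
  exact (differentiable_twoSidedPow k _).comp c (differentiableAt_hillRatio hc)

/-- Cauchy's estimate: a pointwise limit of holomorphic functions, uniformly within `M` of `1` on a
disc of radius `2 r`, is Lipschitz with constant `M / r` on the concentric disc of radius `r`. -/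
lemma norm_limit_sub_le {f : ℕ → ℂ → ℂ} {g : ℂ → ℂ} {z₀ : ℂ} {r M : ℝ} (hr : 0 < r)
    (hd : ∀ N, ∀ z ∈ Metric.ball z₀ (2 * r), DifferentiableAt ℂ (f N) z)
    (hb : ∀ N, ∀ z ∈ Metric.ball z₀ (2 * r), ‖f N z - 1‖ ≤ M)
    (hlim : ∀ z ∈ Metric.ball z₀ (2 * r), Tendsto (fun N => f N z) atTop (𝓝 (g z)))
    {z₁ z₂ : ℂ} (h1 : z₁ ∈ Metric.ball z₀ r) (h2 : z₂ ∈ Metric.ball z₀ r) :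
    ‖g z₁ - g z₂‖ ≤ M / r * ‖z₁ - z₂‖ := by
  have hsub : Metric.ball z₀ r ⊆ Metric.ball z₀ (2 * r) := Metric.ball_subset_ball (by linarith)
  have hN : ∀ N, ‖f N z₁ - f N z₂‖ ≤ M / r * ‖z₁ - z₂‖ := fun N => by
    refine Convex.norm_image_sub_le_of_norm_deriv_le (fun z hz => hd N z (hsub hz)) ?_
      (convex_ball z₀ r) h2 h1
    intro z hz
    have hcl : Metric.closedBall z r ⊆ Metric.ball z₀ (2 * r) := fun w hw => by
      rw [Metric.mem_ball] at hz ⊢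
      rw [Metric.mem_closedBall] at hw
      linarith [dist_triangle w z z₀]
    have hdc : DiffContOnCl ℂ (fun w => f N w - 1) (Metric.ball z r) := by
      refine DifferentiableOn.diffContOnCl fun w hw => ?_
      rw [closure_ball z hr.ne'] at hw
      exact ((hd N w (hcl hw)).sub_const 1).differentiableWithinAt
    have := Complex.norm_deriv_le_of_forall_mem_sphere_norm_le hr hdc fun w hw =>
      hb N w (hcl (Metric.sphere_subset_closedBall hw))
    rwa [deriv_sub_const] at this
  exact le_of_tendsto (((hlim z₁ (hsub h1)).sub (hlim z₂ (hsub h2))).norm)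
    (Eventually.of_forall hN)

/-- The facts about Hill's determinant near `c = 0`, for `Λ = g₀ - s` with `s` near a point `s₀` of
`(0, 1)`: it converges, it is `1 + O(c²)`, it varies slowly in `c` near a point `i p` of the
imaginary axis, and it is Lipschitz in `s`. -/
lemma exists_hillDet_estimates {s₀ : ℝ} (hs0 : 0 < s₀) (hs1 : s₀ < 1) :
    ∃ ε, 0 < ε ∧ ε ≤ 1 / 2 ∧ ∃ C, 0 ≤ C ∧ ∃ η, 0 < η ∧
      (∀ c ∈ upperPart, ‖c‖ < ε → ∀ s : ℂ, ‖s - s₀‖ < 2 * η →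
        0 < (1 + hillAmp c - s).re ∧
        (∀ n : ℤ, 1 + hillAmp c - s ≠ (n : ℂ) ^ 2) ∧
        Tendsto (hillDetTrunc c (1 + hillAmp c - s)) atTop
          (𝓝 (hillDet c (1 + hillAmp c - s))) ∧
        ‖hillDet c (1 + hillAmp c - s) - 1‖ ≤ C * ‖c‖ ^ 2) ∧
      (∀ s : ℂ, ‖s - s₀‖ < 2 * η → ∀ p : ℝ, 0 < p → 2 * p < ε →
        ∀ c₁ ∈ Metric.ball (Complex.I * p) (p / 4), ∀ c₂ ∈ Metric.ball (Complex.I * p) (p / 4),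
        ‖hillDet c₁ (1 + hillAmp c₁ - s) - hillDet c₂ (1 + hillAmp c₂ - s)‖ ≤
          16 * C * p * ‖c₁ - c₂‖) ∧
      (∀ c ∈ upperPart, ‖c‖ < ε → ∀ s₁ s₂ : ℂ, ‖s₁ - s₀‖ < η → ‖s₂ - s₀‖ < η →
        ‖hillDet c (1 + hillAmp c - s₁) - hillDet c (1 + hillAmp c - s₂)‖ ≤
          C / η * ‖s₁ - s₂‖) := by
  obtain ⟨α, hα, hα1, hα2⟩ : ∃ α, 0 < α ∧ 2 * α ≤ 1 - s₀ ∧ 2 * α ≤ s₀ :=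
    ⟨min (1 - s₀) s₀ / 2, by have : 0 < min (1 - s₀) s₀ := lt_min (by linarith) hs0
                             linarith, by linarith [min_le_left (1 - s₀) s₀],
      by linarith [min_le_right (1 - s₀) s₀]⟩
  obtain ⟨ε, hε, hε2, C, hC, hdet⟩ := exists_hillDet_bound hα
  have hre : ∀ c : ℂ, ‖c‖ < min ε (α / 4) → ∀ s : ℂ, ‖s - s₀‖ < 2 * (α / 4) →
      α ≤ (1 + hillAmp c - s).re ∧ (1 + hillAmp c - s).re ≤ 1 - α := by
    intro c hc s hs
    have h1 := norm_hillAmp_le (c := c) (by linarith [min_le_left ε (α / 4)])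
    have h2 := Complex.abs_re_le_norm (hillAmp c)
    have h3 := Complex.abs_re_le_norm (s - s₀)
    have h4 : ‖c‖ < α / 4 := hc.trans_le (min_le_right _ _)
    rw [Complex.sub_re, Complex.ofReal_re] at h3
    simp only [Complex.sub_re, Complex.add_re, Complex.one_re]
    obtain ⟨h5, h6⟩ := abs_le.1 (h2.trans h1)
    obtain ⟨h7, h8⟩ := abs_le.1 (h3.trans hs.le)
    constructor <;> linarith
  have hmin : ∀ {c : ℂ}, ‖c‖ < min ε (α / 4) → ‖c‖ < ε := fun h => h.trans_le (min_le_left _ _)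
  have hone : ∀ {c : ℂ}, ‖c‖ < min ε (α / 4) → ‖c‖ < 1 := fun h => by linarith [hmin h]
  refine ⟨min ε (α / 4), lt_min hε (by linarith), (min_le_left _ _).trans hε2, C, hC, α / 4,
    by linarith, ?_, ?_, ?_⟩
  · intro c hu hc s hs
    obtain ⟨h1, h2⟩ := hre c hc s hs
    obtain ⟨h3, h4⟩ := hdet c _ hu (hmin hc) h1 h2
    exact ⟨by linarith, fun n => sub_ne_zero.1 (ne_sq_of_re hα h1 h2 n), h4,
      le_of_tendsto (h4.sub_const 1).norm (Eventually.of_forall h3)⟩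
  · intro s hs p hp hpε c₁ hc₁ c₂ hc₂
    -- the disc of radius `p / 2` about `i p` lies in the upper half-plane
    have hball : ∀ c ∈ Metric.ball (Complex.I * p) (2 * (p / 4)),
        0 < c.im ∧ ‖c‖ ≤ 2 * p ∧ ‖c‖ < min ε (α / 4) := by
      intro c hc
      rw [Metric.mem_ball, dist_eq_norm] at hc
      have h1 := Complex.abs_im_le_norm (c - Complex.I * p)
      have h2 := norm_sub_norm_le c (Complex.I * p)
      simp only [Complex.sub_im, Complex.mul_im, Complex.I_re, Complex.I_im, Complex.ofReal_re,
        Complex.ofReal_im, norm_mul, Complex.norm_I, Complex.norm_real, Real.norm_eq_abs,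
        abs_of_pos hp] at h1 h2
      have h3 := (abs_le.1 h1).1
      refine ⟨by linarith, by linarith, by linarith⟩
    have := norm_limit_sub_le (f := fun N c => hillDetTrunc c (1 + hillAmp c - s) N)
      (g := fun c => hillDet c (1 + hillAmp c - s)) (z₀ := Complex.I * p) (r := p / 4)
      (M := C * (2 * p) ^ 2) (by linarith) ?_ ?_ ?_ hc₁ hc₂
    · refine this.trans (le_of_eq ?_)
      field_simp
      ring
    · intro N c hc
      obtain ⟨h1, -, h2⟩ := hball c hc
      obtain ⟨h3, h4⟩ := hre c h2 s hs
      refine differentiableAt_hillDetTrunc (γ := fun c => c) (L := fun c => 1 + hillAmp c - s) N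
        (fun k _ => differentiableAt_hillCoeff (hone h2) h1 k)
        (((differentiableAt_hillAmp (hone h2)).const_add 1).sub_const s)
        (ne_sq_of_re hα h3 h4)
    · intro N c hc
      obtain ⟨h1, h5, h2⟩ := hball c hc
      obtain ⟨h3, h4⟩ := hre c h2 s hs
      refine ((hdet c _ (Or.inl h1) (hmin h2) h3 h4).1 N).trans ?_
      exact mul_le_mul_of_nonneg_left (pow_le_pow_left₀ (norm_nonneg _) h5 2) hC
    · intro c hc
      obtain ⟨h1, -, h2⟩ := hball c hc
      obtain ⟨h3, h4⟩ := hre c h2 s hs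
      exact (hdet c _ (Or.inl h1) (hmin h2) h3 h4).2
  · intro c hu hc s₁ s₂ hs₁ hs₂
    have := norm_limit_sub_le (f := fun N s => hillDetTrunc c (1 + hillAmp c - s) N)
      (g := fun s => hillDet c (1 + hillAmp c - s)) (z₀ := (s₀ : ℂ)) (r := α / 4)
      (M := C) (z₁ := s₁) (z₂ := s₂) (by linarith) ?_ ?_ ?_ ?_ ?_
    · exact this
    · intro N s hs
      obtain ⟨h3, h4⟩ := hre c hc s (by rwa [Metric.mem_ball, dist_eq_norm] at hs)
      exact differentiableAt_hillDetTrunc (γ := fun _ => c) (L := fun s => 1 + hillAmp c - s) N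
        (fun k _ => differentiableAt_const _) (differentiableAt_id.const_sub _)
        (ne_sq_of_re hα h3 h4)
    · intro N s hs
      obtain ⟨h3, h4⟩ := hre c hc s (by rwa [Metric.mem_ball, dist_eq_norm] at hs)
      refine ((hdet c _ hu (hmin hc) h3 h4).1 N).trans ?_
      exact mul_le_of_le_one_right hC (pow_le_one₀ (norm_nonneg _) (hone hc).le)
    · intro s hs
      obtain ⟨h3, h4⟩ := hre c hc s (by rwa [Metric.mem_ball, dist_eq_norm] at hs)
      exact (hdet c _ hu (hmin hc) h3 h4).2
    · rwa [Metric.mem_ball, dist_eq_norm]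
    · rwa [Metric.mem_ball, dist_eq_norm]

/-! ### The function `sin² (π √z)` -/

/-- The function `z ↦ sin² (π √z)`. -/
def sinSqSqrt (z : ℂ) : ℂ := Complex.sin ((Real.pi : ℂ) * z ^ (1 / 2 : ℂ)) ^ 2

lemma sinSqSqrt_sq (x : ℝ) : sinSqSqrt ((x : ℂ) ^ 2) = ((Real.sin (Real.pi * x) ^ 2 : ℝ) : ℂ) := by
  have h : ((x : ℂ) ^ 2) ^ (1 / 2 : ℂ) = ((|x| : ℝ) : ℂ) := by
    rw [← Complex.ofReal_pow, show (1 / 2 : ℂ) = ((1 / 2 : ℝ) : ℂ) by push_cast; ring,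
      ← Complex.ofReal_cpow (sq_nonneg x), ← Real.sqrt_eq_rpow, Real.sqrt_sq_eq_abs]
  rw [sinSqSqrt, h, ← Complex.ofReal_mul, ← Complex.ofReal_sin, ← Complex.ofReal_pow]
  congr 1
  rcases abs_choice x with h | h <;> simp [h]

/-- The Evans function in terms of `S(z) = sin² (π √z)`: the identity
`-2 + 2 cos (2 π θ) = -4 sin² (π θ) = -4 S((θ + l)²)` holds for every integer `l`. -/
lemma evansE_eq (c : ℂ) (θ d : ℝ) (l : ℤ) :
    evansE c θ d = 4 * (hillDet c (hillCoeff c 0 - (d : ℂ) ^ 2) *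
      sinSqSqrt (hillCoeff c 0 - (d : ℂ) ^ 2) - sinSqSqrt (((θ + l) ^ 2 : ℝ) : ℂ)) := by
  have h1 : Real.cos (2 * Real.pi * θ) = 1 - 2 * Real.sin (Real.pi * (θ + l)) ^ 2 := by
    have h2 : 2 * Real.pi * θ + l * (2 * Real.pi) = 2 * (Real.pi * (θ + l)) := by ring
    rw [← Real.cos_add_int_mul_two_pi _ l, h2, Real.cos_two_mul, Real.cos_sq']
    ring
  rw [evansE, Complex.ofReal_pow, sinSqSqrt_sq, h1, sinSqSqrt]
  push_cast
  ring

/-- The derivative of `sin² (π √z)` at a point of `(0, 1)` is real, and vanishes only at `1 / 4`. -/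
lemma exists_hasStrictDerivAt_sinSqSqrt {s : ℝ} (h0 : 0 < s) (h1 : s < 1) (h4 : s ≠ 1 / 4) :
    ∃ κ : ℝ, κ ≠ 0 ∧ HasStrictDerivAt sinSqSqrt (κ : ℂ) (s : ℂ) := by
  set r := Real.sqrt s with hr
  have hr0 : 0 < r := Real.sqrt_pos.2 h0
  have hrs : r ^ 2 = s := Real.sq_sqrt h0.le
  have hr1 : r < 1 := by nlinarith
  have hpi := Real.pi_pos
  have hroot : (s : ℂ) ^ (1 / 2 : ℂ) = (r : ℂ) := by
    rw [show (1 / 2 : ℂ) = ((1 / 2 : ℝ) : ℂ) by push_cast; ring,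
      ← Complex.ofReal_cpow h0.le, ← Real.sqrt_eq_rpow]
  have hs0 : (s : ℂ) ≠ 0 := by exact_mod_cast h0.ne'
  have hrc : (r : ℂ) ≠ 0 := by exact_mod_cast hr0.ne'
  have hroot' : (s : ℂ) ^ (1 / 2 - 1 : ℂ) = 1 / (r : ℂ) := by
    rw [Complex.cpow_sub _ _ hs0, hroot, Complex.cpow_one, ← hrs]
    push_cast
    field_simp
  refine ⟨Real.sin (Real.pi * r) * Real.cos (Real.pi * r) * Real.pi / r, ?_, ?_⟩
  · have hsin : Real.sin (Real.pi * r) ≠ 0 :=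
      (Real.sin_pos_of_pos_of_lt_pi (by positivity) (by nlinarith)).ne'
    have hcos : Real.cos (Real.pi * r) ≠ 0 := fun h => by
      have h5 : Real.pi * r = Real.pi / 2 :=
        Real.injOn_cos ⟨by positivity, by nlinarith⟩ ⟨by positivity, by linarith⟩
          (by rw [h, Real.cos_pi_div_two])
      have h6 : r = 1 / 2 := by
        have : Real.pi * (r - 1 / 2) = 0 := by linarith
        rcases mul_eq_zero.1 this with h | h <;> linarith
      exact h4 (by rw [← hrs, h6]; norm_num)
    positivity
  · have h2 : HasStrictDerivAt (fun z : ℂ => z ^ (1 / 2 : ℂ)) (1 / (2 * r)) (s : ℂ) := by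
      have := (hasStrictDerivAt_id (s : ℂ)).cpow (hasStrictDerivAt_const (s : ℂ) (1 / 2 : ℂ))
        (Or.inl (by simpa using h0))
      refine HasStrictDerivAt.congr_deriv (f := fun z : ℂ => z ^ (1 / 2 : ℂ)) this ?_
      simp only [id_eq, hroot']
      field_simp
      ring
    have h3 := ((h2.const_mul (Real.pi : ℂ)).csin).pow 2
    refine HasStrictDerivAt.congr_deriv (f := sinSqSqrt) h3 ?_
    rw [hroot]
    push_cast
    field_simp

lemma conj_sinSqSqrt {s : ℝ} (h : 0 < s) : (starRingEnd ℂ) (sinSqSqrt s) = sinSqSqrt s := by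
  have : (s : ℂ) = ((Real.sqrt s : ℝ) : ℂ) ^ 2 := by
    rw [← Complex.ofReal_pow, Real.sq_sqrt h.le]
  rw [this, sinSqSqrt_sq, Complex.conj_ofReal]

/-! ### Birth of a root at a transversal crossing -/

/-- An abstract crossing lemma. Suppose that on `upperPart`, near the origin, `F c t` is `i c - ρ t`
up to a small multiple of `i c - ρ t` and a quadratic error, that it has slope close to `i` near the
point `-i ρ` when `ρ < 0`, that it is real on the imaginary axis, and that it is continuous in `t`.
If `ρ` changes sign from positive to negative at `t = 0`, then a single root `i y(t)` is born there,
with `y ≈ -ρ`. -/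
lemma exists_root_curve {F : ℂ → ℝ → ℂ} {ρ : ℝ → ℝ} {ε₀ δ₀ K v : ℝ} (hε₀ : 0 < ε₀) (hδ₀ : 0 < δ₀)
    (hK : 0 ≤ K) (hv : 0 < v) (hρc : ContinuousOn ρ (Set.Ioo (-δ₀) δ₀)) (hρ0 : ρ 0 = 0)
    (hρ : HasDerivAt ρ (-(2 * v)) 0)
    (happrox : ∀ t ∈ Set.Ioo (-δ₀) δ₀, ∀ c ∈ upperPart, ‖c‖ < ε₀ →
      ‖F c t - (Complex.I * c - ρ t)‖ ≤ 1 / 8 * ‖Complex.I * c - ρ t‖ + K * ‖c‖ ^ 2)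
    (hslope : ∀ t ∈ Set.Ioo (-δ₀) δ₀, ∀ p : ℝ, p = -ρ t → 0 < p → 2 * p < ε₀ →
      ∀ c₁ ∈ Metric.ball (Complex.I * p) (p / 4), ∀ c₂ ∈ Metric.ball (Complex.I * p) (p / 4),
      ‖F c₁ t - F c₂ t - Complex.I * (c₁ - c₂)‖ ≤ 1 / 2 * ‖c₁ - c₂‖)
    (hcont : ∀ c ∈ upperPart, ‖c‖ < ε₀ → ContinuousOn (F c) (Set.Ioo (-δ₀) δ₀))
    (hreal : ∀ t ∈ Set.Ioo (-δ₀) δ₀, ∀ y : ℝ, 0 < y → y < ε₀ → (F (Complex.I * y) t).im = 0) :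
    ∃ ε, 0 < ε ∧ ε ≤ ε₀ ∧ ∃ δ, 0 < δ ∧ δ ≤ δ₀ ∧
      (∀ t ∈ Set.Ioo (-δ) 0, ∀ c ∈ upperPart, ‖c‖ < ε → F c t ≠ 0) ∧
      (∀ c ∈ upperPart, ‖c‖ < ε → (F c 0 = 0 ↔ c = 0)) ∧
      ∃ y : ℝ → ℝ, y 0 = 0 ∧ ContinuousOn y (Set.Ico 0 δ) ∧
        (∀ t ∈ Set.Ioo 0 δ, 0 < y t ∧ y t < ε ∧
          ∀ c ∈ upperPart, ‖c‖ < ε → (F c t = 0 ↔ c = Complex.I * y t)) ∧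
        HasDerivWithinAt y (2 * v) (Set.Ici 0) 0 := by
  -- the radius `ε` makes the quadratic error at most `‖c‖ / 32`
  obtain ⟨ε, hε, hεε₀, hKε⟩ : ∃ ε, 0 < ε ∧ ε ≤ ε₀ ∧ K * ε ≤ 1 / 32 := by
    refine ⟨min ε₀ (1 / (32 * (K + 1))), lt_min hε₀ (by positivity), min_le_left _ _, ?_⟩
    calc K * min ε₀ (1 / (32 * (K + 1))) ≤ K * (1 / (32 * (K + 1))) :=
          mul_le_mul_of_nonneg_left (min_le_right _ _) hK
      _ ≤ 1 / 32 := by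
          rw [mul_one_div, div_le_div_iff₀ (by positivity) (by norm_num)]
          linarith
  obtain ⟨δ, hδ, hδδ₀, hρsmall, hρneg, hρpos⟩ : ∃ δ, 0 < δ ∧ δ ≤ δ₀ ∧
      (∀ t ∈ Set.Ioo (-δ) δ, |ρ t| < ε / 4) ∧ (∀ t ∈ Set.Ioo (-δ) 0, 0 < ρ t) ∧
      (∀ t ∈ Set.Ioo 0 δ, ρ t < 0) := by
    have h1 : ∀ᶠ t in 𝓝 (0 : ℝ), |ρ t| < ε / 4 := by
      have := hρ.continuousAt.abs
      refine this.eventually (gt_mem_nhds ?_)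
      change |ρ 0| < ε / 4
      rw [hρ0, abs_zero]
      linarith
    have h2 : ∀ᶠ t in 𝓝 (0 : ℝ), ‖ρ t - ρ 0 - (t - 0) • (-(2 * v))‖ ≤ v * ‖t - 0‖ :=
      (hasDerivAt_iff_isLittleO.1 hρ).bound hv
    obtain ⟨δ, hδ, h⟩ := Metric.eventually_nhds_iff.1 (h1.and h2)
    have h' : ∀ t : ℝ, |t| < δ → |ρ t| < ε / 4 ∧ |ρ t + 2 * v * t| ≤ v * |t| := by
      intro t ht
      have := h (y := t) (by rwa [Real.dist_eq, sub_zero])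
      refine ⟨this.1, ?_⟩
      have h3 := this.2
      rw [hρ0, sub_zero, sub_zero, smul_eq_mul, Real.norm_eq_abs, Real.norm_eq_abs] at h3
      rwa [show ρ t + 2 * v * t = ρ t - t * -(2 * v) by ring]
    refine ⟨min δ δ₀, lt_min hδ hδ₀, min_le_right _ _, fun t ht => ?_, fun t ht => ?_,
      fun t ht => ?_⟩
    · exact (h' t (abs_lt.2 ⟨by linarith [ht.1, min_le_left δ δ₀],
        ht.2.trans_le (min_le_left _ _)⟩)).1
    · have h3 := (h' t (by rw [abs_of_neg ht.2]; linarith [ht.1, min_le_left δ δ₀])).2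
      rw [abs_of_neg ht.2] at h3
      have := (abs_le.1 h3).1
      nlinarith [ht.2, mul_pos hv (neg_pos.2 ht.2)]
    · have h3 := (h' t (by rw [abs_of_pos ht.1]; linarith [ht.2, min_le_left δ δ₀])).2
      rw [abs_of_pos ht.1] at h3
      have := (abs_le.1 h3).2
      nlinarith [ht.1, mul_pos hv ht.1]
  have hmem : ∀ {t : ℝ}, t ∈ Set.Ioo (-δ) δ → t ∈ Set.Ioo (-δ₀) δ₀ := fun ht =>
    ⟨by linarith [ht.1], by linarith [ht.2]⟩
  -- at a root, `i c` agrees with `ρ` up to a quadratic error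
  have hroot : ∀ t ∈ Set.Ioo (-δ) δ, ∀ c ∈ upperPart, ‖c‖ < ε → F c t = 0 →
      ‖Complex.I * c - ρ t‖ ≤ 2 * K * ‖c‖ ^ 2 ∧ ‖Complex.I * c - ρ t‖ ≤ 1 / 16 * ‖c‖ := by
    intro t ht c hu hc h0
    have h1 := happrox t (hmem ht) c hu (by linarith)
    rw [h0, zero_sub, norm_neg] at h1
    have h2 : K * ‖c‖ ^ 2 ≤ 1 / 32 * ‖c‖ := by
      have h3 : K * ‖c‖ ≤ 1 / 32 := (mul_le_mul_of_nonneg_left hc.le hK).trans hKε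
      nlinarith [norm_nonneg c]
    have h3 := norm_nonneg (Complex.I * c - ρ t)
    have h4 : 0 ≤ K * ‖c‖ ^ 2 := by positivity
    constructor <;> linarith [norm_nonneg c]
  -- so for `ρ ≤ 0` it lies well inside the disc of radius `|ρ| / 4` about `-i ρ`
  have hnear : ∀ t ∈ Set.Ioo (-δ) δ, ∀ c ∈ upperPart, ‖c‖ < ε → F c t = 0 →
      ‖c‖ ≤ 16 / 15 * |ρ t| ∧ ‖c - Complex.I * ((-ρ t : ℝ) : ℂ)‖ ≤ 1 / 15 * |ρ t| := by
    intro t ht c hu hc h0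
    have h1 := (hroot t ht c hu hc h0).2
    have h2 : c - Complex.I * ((-ρ t : ℝ) : ℂ) = -Complex.I * (Complex.I * c - ρ t) := by
      push_cast
      linear_combination c * Complex.I_sq
    have h3 : ‖c - Complex.I * ((-ρ t : ℝ) : ℂ)‖ = ‖Complex.I * c - ρ t‖ := by
      rw [h2, norm_mul, norm_neg, Complex.norm_I, one_mul]
    have h4 := norm_sub_norm_le (Complex.I * c) (ρ t)
    rw [norm_mul, Complex.norm_I, one_mul, Complex.norm_real, Real.norm_eq_abs] at h4
    rw [h3]
    constructor <;> linarith
  -- existence: the intermediate value theorem on the segment `i [4p/5, 6p/5]`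
  have hexist : ∀ t ∈ Set.Ioo 0 δ, ∃ y : ℝ, 0 < y ∧ y < ε ∧ F (Complex.I * y) t = 0 := by
    intro t ht
    have htδ : t ∈ Set.Ioo (-δ) δ := ⟨by linarith [ht.1], ht.2⟩
    obtain ⟨p, hp⟩ : ∃ p, p = -ρ t := ⟨_, rfl⟩
    have hp0 : 0 < p := by linarith [hρpos t ht]
    have hpε : p < ε / 4 := by
      have := hρsmall t htδ
      rw [abs_of_neg (hρpos t ht)] at this
      linarith
    have hKp : K * p ≤ 1 / 128 := by nlinarith
    have hre : ∀ y : ℝ, 0 < y → y < ε → |(F (Complex.I * y) t).re - (p - y)| ≤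
        1 / 8 * |p - y| + K * y ^ 2 := by
      intro y hy hyε
      have hn : ‖Complex.I * (y : ℂ)‖ = y := by
        rw [norm_mul, Complex.norm_I, one_mul, Complex.norm_real, Real.norm_eq_abs,
          abs_of_pos hy]
      have h1 := happrox t (hmem htδ) (Complex.I * y) (Or.inl (by simpa using hy))
        (by rw [hn]; linarith)
      have h2 : Complex.I * (Complex.I * y) - ρ t = ((p - y : ℝ) : ℂ) := by
        rw [hp]
        push_cast
        linear_combination (y : ℂ) * Complex.I_sq
      rw [h2, hn, Complex.norm_real, Real.norm_eq_abs] at h1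
      refine le_trans ?_ h1
      have := Complex.abs_re_le_norm (F (Complex.I * y) t - ((p - y : ℝ) : ℂ))
      rwa [Complex.sub_re, Complex.ofReal_re] at this
    have hball : ∀ y ∈ Set.Icc (4 / 5 * p) (6 / 5 * p),
        Complex.I * (y : ℂ) ∈ Metric.ball (Complex.I * (p : ℂ)) (p / 4) := by
      intro y hy
      rw [Metric.mem_ball, dist_eq_norm, ← mul_sub, norm_mul, Complex.norm_I, one_mul,
        ← Complex.ofReal_sub, Complex.norm_real, Real.norm_eq_abs, abs_lt]
      constructor <;> linarith [hy.1, hy.2]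
    have hlip : LipschitzOnWith 2 (fun y : ℝ => (F (Complex.I * y) t).re)
        (Set.Icc (4 / 5 * p) (6 / 5 * p)) := by
      refine LipschitzOnWith.of_dist_le_mul fun y₁ h1 y₂ h2 => ?_
      have h3 := hslope t (hmem htδ) p hp hp0 (by linarith) _ (hball y₁ h1) _ (hball y₂ h2)
      have h4 : ‖Complex.I * (y₁ : ℂ) - Complex.I * y₂‖ = dist y₁ y₂ := by
        rw [← mul_sub, norm_mul, Complex.norm_I, one_mul, ← Complex.ofReal_sub,
          Complex.norm_real, Real.norm_eq_abs, Real.dist_eq]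
      have h5 := norm_sub_norm_le (F (Complex.I * y₁) t - F (Complex.I * y₂) t)
        (Complex.I * (Complex.I * (y₁ : ℂ) - Complex.I * y₂))
      rw [norm_mul, Complex.norm_I, one_mul] at h5
      rw [h4] at h3 h5
      rw [Real.dist_eq, ← Complex.sub_re]
      have h6 := Complex.abs_re_le_norm (F (Complex.I * y₁) t - F (Complex.I * y₂) t)
      have h7 : (0 : ℝ) ≤ dist y₁ y₂ := dist_nonneg
      simp only [NNReal.coe_ofNat]
      linarith
    obtain ⟨y, hy, hy0⟩ : (0 : ℝ) ∈ (fun y : ℝ => (F (Complex.I * y) t).re) ''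
        Set.Icc (4 / 5 * p) (6 / 5 * p) := by
      refine intermediate_value_Icc' (by linarith) hlip.continuousOn ⟨?_, ?_⟩
      · have h1 := hre (6 / 5 * p) (by linarith) (by linarith)
        rw [show p - 6 / 5 * p = -(1 / 5 * p) by ring, abs_neg,
          abs_of_pos (by linarith : 0 < 1 / 5 * p)] at h1
        have := (abs_le.1 h1).2
        nlinarith
      · have h1 := hre (4 / 5 * p) (by linarith) (by linarith)
        rw [show p - 4 / 5 * p = 1 / 5 * p by ring,
          abs_of_pos (by linarith : 0 < 1 / 5 * p)] at h1
        have := (abs_le.1 h1).1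
        nlinarith
    have hy1 : 0 < y := by linarith [hy.1]
    have hy2 : y < ε := by linarith [hy.2]
    exact ⟨y, hy1, hy2, Complex.ext hy0 (hreal t (hmem htδ) y hy1 (by linarith))⟩
  choose! y hy0 hyε hyF using hexist
  have hyn : ∀ {x : ℝ}, 0 ≤ x → ‖Complex.I * (x : ℂ)‖ = x := fun hx => by
    rw [norm_mul, Complex.norm_I, one_mul, Complex.norm_real, Real.norm_eq_abs, abs_of_nonneg hx]
  have hyu : ∀ {x : ℝ}, 0 < x → Complex.I * (x : ℂ) ∈ upperPart := fun hx =>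
    Or.inl (by simpa using hx)
  have hsub : ∀ {t : ℝ}, t ∈ Set.Ioo 0 δ → t ∈ Set.Ioo (-δ) δ := fun ht =>
    ⟨by linarith [ht.1], ht.2⟩
  have hmemball : ∀ t ∈ Set.Ioo 0 δ, ∀ c ∈ upperPart, ‖c‖ < ε → F c t = 0 →
      c ∈ Metric.ball (Complex.I * ((-ρ t : ℝ) : ℂ)) (-ρ t / 4) := by
    intro t ht c hu hc h0
    have h1 := (hnear t (hsub ht) c hu hc h0).2
    have h2 := hρpos t ht
    rw [abs_of_neg h2] at h1
    rw [Metric.mem_ball, dist_eq_norm]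
    linarith
  have hεp : ∀ t ∈ Set.Ioo 0 δ, 2 * -ρ t < ε₀ := fun t ht => by
    have := hρsmall t (hsub ht)
    rw [abs_of_neg (hρpos t ht)] at this
    linarith
  have hlower : ∀ t ∈ Set.Ioo 0 δ,
      ∀ c₁ ∈ Metric.ball (Complex.I * ((-ρ t : ℝ) : ℂ)) (-ρ t / 4),
      ∀ c₂ ∈ Metric.ball (Complex.I * ((-ρ t : ℝ) : ℂ)) (-ρ t / 4),
      ‖c₁ - c₂‖ ≤ 2 * ‖F c₁ t - F c₂ t‖ := by
    intro t ht c₁ h1 c₂ h2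
    have h3 := hslope t (hmem (hsub ht)) (-ρ t) rfl (by linarith [hρpos t ht]) (hεp t ht)
      c₁ h1 c₂ h2
    have h4 := norm_sub_norm_le (Complex.I * (c₁ - c₂)) (F c₁ t - F c₂ t)
    rw [norm_mul, Complex.norm_I, one_mul, norm_sub_rev (Complex.I * (c₁ - c₂))] at h4
    linarith
  have hyρ : ∀ t ∈ Set.Ioo 0 δ, y t ≤ 2 * |ρ t| ∧ |y t + ρ t| ≤ 8 * K * |ρ t| ^ 2 := by
    intro t ht
    have h1 := (hnear t (hsub ht) _ (hyu (hy0 t ht)) (by rw [hyn (hy0 t ht).le]; exact hyε t ht)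
      (hyF t ht)).1
    have h2 := (hroot t (hsub ht) _ (hyu (hy0 t ht))
      (by rw [hyn (hy0 t ht).le]; exact hyε t ht) (hyF t ht)).1
    rw [hyn (hy0 t ht).le] at h1 h2
    have h3 : Complex.I * (Complex.I * y t) - ρ t = ((-(y t + ρ t) : ℝ) : ℂ) := by
      push_cast
      linear_combination (y t : ℂ) * Complex.I_sq
    rw [h3, Complex.norm_real, Real.norm_eq_abs, abs_neg] at h2
    have h4 : y t ≤ 2 * |ρ t| := by linarith [abs_nonneg (ρ t)]
    refine ⟨h4, h2.trans ?_⟩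
    have h5 : y t ^ 2 ≤ (2 * |ρ t|) ^ 2 := pow_le_pow_left₀ (hy0 t ht).le h4 2
    nlinarith
  have hderiv : HasDerivWithinAt (fun t => if 0 < t then y t else 0) (2 * v) (Set.Ici 0) 0 := by
    -- `y + ρ = O(ρ²)` and `ρ ≈ -2 v t`
    have h1 : HasDerivWithinAt (fun t => (if 0 < t then y t else 0) + ρ t) 0 (Set.Ici 0) 0 := by
      have hO : (fun t => (if 0 < t then y t else 0) + ρ t) =O[𝓝[≥] 0] fun t => ρ t ^ 2 := by
        refine Asymptotics.IsBigO.of_bound (8 * K) ?_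
        have hmemδ : Set.Ico 0 δ ∈ 𝓝[≥] (0 : ℝ) := Ico_mem_nhdsGE hδ
        filter_upwards [hmemδ] with t ht
        rcases ht.1.eq_or_lt with h | h
        · subst h
          simp [hρ0]
        · rw [if_pos h, Real.norm_eq_abs, norm_pow, Real.norm_eq_abs]
          exact (hyρ t ⟨h, ht.2⟩).2
      have hρO : ρ =O[𝓝[≥] 0] fun t => t := by
        have := hρ.isBigO_sub
        simpa [hρ0] using this.mono nhdsWithin_le_nhds
      have ho : (fun t => ρ t ^ 2) =o[𝓝[≥] 0] fun t : ℝ => t := by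
        refine (hρO.pow 2).trans_isLittleO ?_
        exact (Asymptotics.isLittleO_pow_id one_lt_two).mono nhdsWithin_le_nhds
      rw [hasDerivWithinAt_iff_isLittleO]
      simpa [hρ0] using hO.trans_isLittleO ho
    have h2 := h1.sub hρ.hasDerivWithinAt
    refine (HasDerivWithinAt.congr_deriv h2 (by ring)).congr_of_eventuallyEq ?_ ?_
    · exact Eventually.of_forall fun t => by simp
    · simp
  refine ⟨ε, hε, hεε₀, δ, hδ, hδδ₀, ?_, ?_, fun t => if 0 < t then y t else 0, by simp, ?_, ?_,
    hderiv⟩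
  · intro t ht c hu hc h0
    have htδ : t ∈ Set.Ioo (-δ) δ := ⟨ht.1, by linarith [ht.2]⟩
    have h1 := (hnear t htδ c hu hc h0).2
    have h2 := hρneg t ht
    -- `Im c ≥ 0`, while `-i ρ` lies at distance `ρ` below the real axis
    have h3 := Complex.abs_im_le_norm (c - Complex.I * ((-ρ t : ℝ) : ℂ))
    have h4 : (c - Complex.I * ((-ρ t : ℝ) : ℂ)).im = c.im + ρ t := by simp
    have h5 : 0 ≤ c.im := by
      rcases hu with h | h
      · exact h.le
      · simp [h]
    rw [h4, abs_of_pos (by linarith)] at h3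
    rw [abs_of_pos h2] at h1
    linarith
  · intro c hu hc
    have h0δ : (0 : ℝ) ∈ Set.Ioo (-δ) δ := ⟨by linarith, hδ⟩
    constructor
    · intro h0
      have h1 := (hnear 0 h0δ c hu hc h0).1
      rw [hρ0, abs_zero, mul_zero] at h1
      exact norm_le_zero_iff.1 h1
    · rintro rfl
      have h1 := happrox 0 (hmem h0δ) 0 hu (by simpa using hε₀)
      simpa [hρ0] using h1
  · intro t ht
    rcases ht.1.eq_or_lt with h | h
    · subst h
      exact (hderiv.continuousWithinAt).mono Set.Ico_subset_Ici_self
    · have ht' : t ∈ Set.Ioo 0 δ := ⟨h, ht.2⟩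
      have hnhds : Set.Ioo 0 δ ∈ 𝓝 t := Ioo_mem_nhds ht'.1 ht'.2
      refine ContinuousAt.continuousWithinAt ?_
      have hev : (fun t => if 0 < t then y t else 0) =ᶠ[𝓝 t] y := by
        filter_upwards [hnhds] with s hs using if_pos hs.1
      refine ContinuousAt.congr ?_ hev.symm
      set c := Complex.I * (y t : ℂ) with hc
      have hcn : ‖c‖ < ε := by rw [hc, hyn (hy0 t ht').le]; exact hyε t ht'
      have hcu : c ∈ upperPart := hyu (hy0 t ht')
      have hρt : ContinuousAt ρ t :=
        hρc.continuousAt (Ioo_mem_nhds (hmem (hsub ht')).1 (hmem (hsub ht')).2)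
      have hFt : ContinuousAt (F c) t :=
        (hcont c hcu (by linarith)).continuousAt
          (Ioo_mem_nhds (hmem (hsub ht')).1 (hmem (hsub ht')).2)
      -- `i y(t)` stays in the disc about `-i ρ(s)` for `s` close to `t`
      have hin : ∀ᶠ s in 𝓝 t, c ∈ Metric.ball (Complex.I * ((-ρ s : ℝ) : ℂ)) (-ρ s / 4) := by
        have h1 : ContinuousAt (fun s => -ρ s / 4 - ‖c - Complex.I * ((-ρ s : ℝ) : ℂ)‖) t := by
          fun_prop
        have h2 := hmemball t ht' c hcu hcn (hyF t ht')
        rw [Metric.mem_ball, dist_eq_norm] at h2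
        have h3 := h1.eventually (lt_mem_nhds (sub_pos.2 h2))
        filter_upwards [h3] with s hs
        rw [Metric.mem_ball, dist_eq_norm]
        linarith
      have hle : ∀ᶠ s in 𝓝 t, ‖y s - y t‖ ≤ 2 * ‖F c s‖ := by
        filter_upwards [hin, hnhds] with s hs hsδ
        have h1 := hlower s hsδ (Complex.I * (y s : ℂ))
          (hmemball s hsδ _ (hyu (hy0 s hsδ)) (by rw [hyn (hy0 s hsδ).le]; exact hyε s hsδ)
            (hyF s hsδ)) c hs
        rw [hyF s hsδ, zero_sub, norm_neg, hc, ← mul_sub, norm_mul, Complex.norm_I, one_mul,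
          ← Complex.ofReal_sub, Complex.norm_real] at h1
        exact h1
      have hlim : Tendsto (fun s => 2 * ‖F c s‖) (𝓝 t) (𝓝 0) := by
        have h1 := (hFt.norm.const_mul 2).tendsto
        rwa [hyF t ht', norm_zero, mul_zero] at h1
      exact tendsto_iff_norm_sub_tendsto_zero.2
        (squeeze_zero' (Eventually.of_forall fun _ => norm_nonneg _) hle hlim)
  · intro t ht
    simp only [if_pos ht.1]
    refine ⟨hy0 t ht, hyε t ht, fun c hu hc => ⟨fun h0 => ?_, fun h0 => ?_⟩⟩
    · have h1 := hlower t ht c (hmemball t ht c hu hc h0) (Complex.I * (y t : ℂ))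
        (hmemball t ht _ (hyu (hy0 t ht)) (by rw [hyn (hy0 t ht).le]; exact hyε t ht) (hyF t ht))
      rw [h0, hyF t ht, sub_zero, norm_zero, mul_zero] at h1
      exact sub_eq_zero.1 (norm_le_zero_iff.1 h1)
    · rw [h0, hyF t ht]

/-! ### The Evans function near `c = 0` -/

lemma mem_upperPart_or_neg_mem {c : ℂ} (hc : c ∈ evansDomain) (hn : ‖c‖ < 1) :
    c ∈ upperPart ∨ -c ∈ upperPart := by
  rcases hc with rfl | hc
  · exact Or.inl (Or.inr rfl)
  rcases lt_trichotomy c.im 0 with h | h | h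
  · exact Or.inr (Or.inl (by simpa using h))
  · refine absurd (Complex.ext (by simp) (by simp [h]) : c = ((c.re : ℝ) : ℂ)) (hc c.re ?_)
    exact abs_le.1 ((Complex.abs_re_le_norm c).trans hn.le)
  · exact Or.inl (Or.inl h)

lemma mem_evansDomain_of_im_ne_zero {c : ℂ} (h : c.im ≠ 0) : c ∈ evansDomain :=
  Or.inr fun x _ hx => h (by rw [hx, Complex.ofReal_im])

/-- On the imaginary axis the Evans function is real. -/
lemma evansE_I_mul_im {y θ d : ℝ}
    (hpos : 0 < (hillCoeff (Complex.I * y) 0 - (d : ℂ) ^ 2).re)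
    (hlim : Tendsto (hillDetTrunc (Complex.I * y) (hillCoeff (Complex.I * y) 0 - (d : ℂ) ^ 2)) atTop
      (𝓝 (hillDet (Complex.I * y) (hillCoeff (Complex.I * y) 0 - (d : ℂ) ^ 2)))) :
    (evansE (Complex.I * y) θ d).im = 0 := by
  obtain ⟨x, hx⟩ := Complex.conj_eq_iff_real.1
    (show (starRingEnd ℂ) (hillCoeff (Complex.I * y) 0 - (d : ℂ) ^ 2) = _ by
      rw [map_sub, conj_hillCoeff_I_mul, map_pow, Complex.conj_ofReal])
  rw [← Complex.conj_eq_iff_im, evansE_eq _ _ _ 0]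
  rw [hx] at hpos hlim ⊢
  rw [Complex.ofReal_re] at hpos
  have hD : (starRingEnd ℂ) (hillDet (Complex.I * y) x) = hillDet (Complex.I * y) x := by
    have h1 := (Complex.continuous_conj.tendsto _).comp hlim
    refine tendsto_nhds_unique h1 (hlim.congr fun N => ?_)
    exact (conj_hillDetTrunc_I_mul y x N).symm
  have hS : (starRingEnd ℂ) (sinSqSqrt (((θ + (0 : ℤ)) ^ 2 : ℝ) : ℂ)) =
      sinSqSqrt (((θ + (0 : ℤ)) ^ 2 : ℝ) : ℂ) := by
    rw [Complex.ofReal_pow, sinSqSqrt_sq, Complex.conj_ofReal]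
  rw [map_mul, map_sub, map_mul, hD, hS, conj_sinSqSqrt hpos, Complex.conj_ofNat]

lemma HasStrictDerivAt.exists_ball {f : ℂ → ℂ} {f' x : ℂ} (hf : HasStrictDerivAt f f' x) {ε : ℝ}
    (hε : 0 < ε) : ∃ η, 0 < η ∧ ∀ z₁ ∈ Metric.ball x η, ∀ z₂ ∈ Metric.ball x η,
      ‖f z₁ - f z₂ - f' * (z₁ - z₂)‖ ≤ ε * ‖z₁ - z₂‖ := by
  obtain ⟨s, hs, h⟩ := hf.hasStrictFDerivAt.approximates_deriv_on_nhds (c := ⟨ε, hε.le⟩)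
    (Or.inr hε)
  obtain ⟨η, hη, hball⟩ := Metric.mem_nhds_iff.1 hs
  refine ⟨η, hη, fun z₁ h1 z₂ h2 => ?_⟩
  have h3 : ‖f z₁ - f z₂ - (z₁ - z₂) * f'‖ ≤ ε * ‖z₁ - z₂‖ := h z₁ (hball h1) z₂ (hball h2)
  rwa [mul_comm f']

/-- Near a point of `(0, 1)` other than `1 / 4`, the function `sin² (π √z)` is bounded and has
nearly constant slope. -/
lemma exists_sinSqSqrt_estimates {s : ℝ} (h0 : 0 < s) (h1 : s < 1) (h4 : s ≠ 1 / 4) :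
    ∃ κ : ℝ, κ ≠ 0 ∧ ∃ η, 0 < η ∧ ∃ B, 0 ≤ B ∧
      (∀ z ∈ Metric.ball (s : ℂ) η, ‖sinSqSqrt z‖ ≤ B) ∧
      ∀ z₁ ∈ Metric.ball (s : ℂ) η, ∀ z₂ ∈ Metric.ball (s : ℂ) η,
      ‖sinSqSqrt z₁ - sinSqSqrt z₂ - κ * (z₁ - z₂)‖ ≤ |κ| / 16 * ‖z₁ - z₂‖ := by
  obtain ⟨κ, hκ, hS⟩ := exists_hasStrictDerivAt_sinSqSqrt h0 h1 h4
  obtain ⟨η, hη, h2⟩ := hS.exists_ball (show 0 < |κ| / 16 by positivity)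
  obtain ⟨η', hη', h3⟩ := Metric.eventually_nhds_iff_ball.1
    (hS.hasDerivAt.continuousAt.norm.eventually (gt_mem_nhds (lt_add_one _)))
  refine ⟨κ, hκ, min η η', lt_min hη hη', ‖sinSqSqrt s‖ + 1, by positivity,
    fun z hz => (h3 z (Metric.ball_subset_ball (min_le_right _ _) hz)).le,
    fun z₁ hz₁ z₂ hz₂ => h2 _ (Metric.ball_subset_ball (min_le_left _ _) hz₁) _
      (Metric.ball_subset_ball (min_le_left _ _) hz₂)⟩

/-- Error of the first-order expansion of `(D S₁ - S₂) / κ`, where `S₁ - S₂ ≈ κ (a - ρ)`, `D` is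
close to `1` and `a` is close to `x`. The two parts of the error of `D S₁` are separated by
`D S₁ - S₂ = (S₁ - S₂) + (D - 1) S₁`. -/
lemma norm_value_error_le {κ : ℝ} (hκ : κ ≠ 0) {D S₁ S₂ a ρ x : ℂ} {C β q : ℝ} (hC : 0 ≤ C)
    (hq : 0 ≤ q) (hdiff : ‖S₁ - S₂ - κ * (a - ρ)‖ ≤ |κ| / 16 * ‖a - ρ‖) (hD : ‖D - 1‖ ≤ C * q)
    (hS : ‖S₁‖ ≤ |κ| * β) (ha : ‖a - x‖ ≤ q) :
    ‖(D * S₁ - S₂) / κ - (x - ρ)‖ ≤ 1 / 8 * ‖x - ρ‖ + (2 + C * β) * q := by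
  have hκ0 : 0 < |κ| := abs_pos.2 hκ
  have hκC : (κ : ℂ) ≠ 0 := by exact_mod_cast hκ
  have hκn : ‖(κ : ℂ)‖ = |κ| := by rw [Complex.norm_real, Real.norm_eq_abs]
  have hsplit : (D * S₁ - S₂) / κ - (x - ρ) =
      (S₁ - S₂ - κ * (a - ρ)) / κ + (D - 1) * S₁ / κ + (a - x) := by
    field_simp
    ring
  have h1 : ‖(S₁ - S₂ - κ * (a - ρ)) / κ‖ ≤ 1 / 16 * ‖a - ρ‖ := by
    rw [norm_div, hκn, div_le_iff₀ hκ0]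
    linarith
  have h2 : ‖(D - 1) * S₁ / κ‖ ≤ C * β * q := by
    rw [norm_div, norm_mul, hκn, div_le_iff₀ hκ0]
    calc ‖D - 1‖ * ‖S₁‖ ≤ C * q * (|κ| * β) :=
          mul_le_mul hD hS (norm_nonneg _) (by positivity)
      _ = _ := by ring
  have h4 : ‖a - ρ‖ ≤ ‖a - x‖ + ‖x - ρ‖ := norm_sub_le_norm_sub_add_norm_sub _ _ _
  rw [hsplit]
  have h5 := norm_add₃_le (a := (S₁ - S₂ - κ * (a - ρ)) / κ) (b := (D - 1) * S₁ / κ)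
    (c := a - x)
  linarith [norm_nonneg (x - ρ)]

/-- Error of the first-order expansion of the difference of two values of `(D S - S₀) / κ`: here `a`
is the increment of the argument of `S`, and `x` its linear part. The estimate splits
`D₁ S₁ - D₂ S₂ = (S₁ - S₂) + (D₁ - 1) (S₁ - S₂) + (D₁ - D₂) S₂`. -/
lemma norm_slope_error_le {κ : ℝ} (hκ : κ ≠ 0) {D₁ D₂ S₀ S₁ S₂ a x : ℂ} {β : ℝ}
    (hdiff : ‖S₁ - S₂ - κ * a‖ ≤ |κ| / 16 * ‖a‖) (hD₁ : ‖D₁ - 1‖ ≤ 1 / 32)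
    (hD₁₂ : β * ‖D₁ - D₂‖ ≤ 1 / 16 * ‖x‖) (hS : ‖S₂‖ ≤ |κ| * β)
    (ha : ‖a - x‖ ≤ 1 / 16 * ‖x‖) :
    ‖(D₁ * S₁ - S₀) / κ - (D₂ * S₂ - S₀) / κ - x‖ ≤ 1 / 2 * ‖x‖ := by
  have hκ0 : 0 < |κ| := abs_pos.2 hκ
  have hκC : (κ : ℂ) ≠ 0 := by exact_mod_cast hκ
  have hκn : ‖(κ : ℂ)‖ = |κ| := by rw [Complex.norm_real, Real.norm_eq_abs]
  have hsplit : (D₁ * S₁ - S₀) / κ - (D₂ * S₂ - S₀) / κ - x =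
      (S₁ - S₂ - κ * a) / κ + (D₁ - 1) * (S₁ - S₂) / κ + (D₁ - D₂) * S₂ / κ + (a - x) := by
    field_simp
    ring
  have hx := norm_nonneg x
  have ha' : ‖a‖ ≤ 2 * ‖x‖ := by linarith [norm_sub_norm_le a x]
  have hS' : ‖S₁ - S₂‖ ≤ 4 * |κ| * ‖x‖ := by
    have h1 := norm_sub_norm_le (S₁ - S₂) (κ * a)
    rw [norm_mul, hκn] at h1
    have h2 : |κ| * ‖a‖ ≤ |κ| * (2 * ‖x‖) := mul_le_mul_of_nonneg_left ha' hκ0.le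
    have h3 : 0 ≤ |κ| * ‖x‖ := by positivity
    linarith
  have h1 : ‖(S₁ - S₂ - κ * a) / κ‖ ≤ 1 / 16 * ‖a‖ := by
    rw [norm_div, hκn, div_le_iff₀ hκ0]
    linarith
  have h2 : ‖(D₁ - 1) * (S₁ - S₂) / κ‖ ≤ 1 / 8 * ‖x‖ := by
    rw [norm_div, norm_mul, hκn, div_le_iff₀ hκ0]
    calc ‖D₁ - 1‖ * ‖S₁ - S₂‖ ≤ 1 / 32 * (4 * |κ| * ‖x‖) :=
          mul_le_mul hD₁ hS' (norm_nonneg _) (by norm_num)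
      _ = _ := by ring
  have h3 : ‖(D₁ - D₂) * S₂ / κ‖ ≤ 1 / 16 * ‖x‖ := by
    rw [norm_div, norm_mul, hκn, div_le_iff₀ hκ0]
    calc ‖D₁ - D₂‖ * ‖S₂‖ ≤ ‖D₁ - D₂‖ * (|κ| * β) :=
          mul_le_mul_of_nonneg_left hS (norm_nonneg _)
      _ = β * ‖D₁ - D₂‖ * |κ| := by ring
      _ ≤ _ := mul_le_mul_of_nonneg_right hD₁₂ hκ0.le
  rw [hsplit]
  have h5 := norm_add₄_le (a := (S₁ - S₂ - κ * a) / κ) (b := (D₁ - 1) * (S₁ - S₂) / κ)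
    (c := (D₁ - D₂) * S₂ / κ) (d := a - x)
  linarith

/-- The normalised Evans function `E / (4 κ)` satisfies the hypotheses of the abstract crossing
lemma, with `ρ = (θ + l)² + d² - 1`. -/
lemma exists_evansE_estimates (l : ℤ) {θ d : ℝ → ℝ} (hθ : ContDiffAt ℝ 1 θ 0)
    (hd : ContDiffAt ℝ 1 d 0) (hcircle : (θ 0 + l) ^ 2 + d 0 ^ 2 = 1) (hd0 : 0 < d 0 ^ 2)
    (hd1 : d 0 ^ 2 < 1) (hd34 : d 0 ^ 2 ≠ 3 / 4) :
    ∃ κ : ℝ, κ ≠ 0 ∧ ∃ ε, 0 < ε ∧ ε ≤ 1 / 2 ∧ ∃ δ, 0 < δ ∧ ∃ K, 0 ≤ K ∧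
      ContinuousOn (fun t => (θ t + l) ^ 2 + d t ^ 2 - 1) (Set.Ioo (-δ) δ) ∧
      (∀ t ∈ Set.Ioo (-δ) δ, ∀ c ∈ upperPart, ‖c‖ < ε →
        (∀ n : ℤ, hillCoeff c 0 - (d t : ℂ) ^ 2 ≠ (n : ℂ) ^ 2) ∧
        Tendsto (hillDetTrunc c (hillCoeff c 0 - (d t : ℂ) ^ 2)) atTop
          (𝓝 (hillDet c (hillCoeff c 0 - (d t : ℂ) ^ 2)))) ∧
      (∀ t ∈ Set.Ioo (-δ) δ, ∀ c ∈ upperPart, ‖c‖ < ε →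
        ‖evansE c (θ t) (d t) / (4 * κ) -
          (Complex.I * c - (((θ t + l) ^ 2 + d t ^ 2 - 1 : ℝ) : ℂ))‖ ≤
          1 / 8 * ‖Complex.I * c - (((θ t + l) ^ 2 + d t ^ 2 - 1 : ℝ) : ℂ)‖ + K * ‖c‖ ^ 2) ∧
      (∀ t ∈ Set.Ioo (-δ) δ, ∀ p : ℝ, 0 < p → 2 * p < ε →
        ∀ c₁ ∈ Metric.ball (Complex.I * p) (p / 4), ∀ c₂ ∈ Metric.ball (Complex.I * p) (p / 4),
        ‖evansE c₁ (θ t) (d t) / (4 * κ) - evansE c₂ (θ t) (d t) / (4 * κ) -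
          Complex.I * (c₁ - c₂)‖ ≤ 1 / 2 * ‖c₁ - c₂‖) ∧
      (∀ c ∈ upperPart, ‖c‖ < ε →
        ContinuousOn (fun t => evansE c (θ t) (d t) / (4 * κ)) (Set.Ioo (-δ) δ)) ∧
      (∀ t ∈ Set.Ioo (-δ) δ, ∀ y : ℝ, 0 < y → y < ε →
        (evansE (Complex.I * y) (θ t) (d t) / (4 * κ)).im = 0) := by
  obtain ⟨ε₁, hε₁, hε₁2, C, hC, η₁, hη₁, hdet, hdetc, hdets⟩ := exists_hillDet_estimates hd0 hd1
  obtain ⟨κ, hκ, η₂, hη₂, B, hB, hSB, hS⟩ := exists_sinSqSqrt_estimates (s := 1 - d 0 ^ 2)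
    (by linarith) (by linarith) (fun h => hd34 (by linarith))
  obtain ⟨ε₂, hε₂, hamp⟩ := hasStrictDerivAt_hillAmp_zero.exists_ball
    (show (0 : ℝ) < 1 / 16 by norm_num)
  have hκ0 : 0 < |κ| := abs_pos.2 hκ
  obtain ⟨β, hβ⟩ : ∃ β, β = B / |κ| := ⟨_, rfl⟩
  have hβ0 : 0 ≤ β := by rw [hβ]; positivity
  have hBβ : B = |κ| * β := by rw [hβ]; field_simp
  -- the radius `ε`, and the constraints it satisfies
  obtain ⟨ε, hε, hεε₁, hεε₂, hεη, hCε, hCβε⟩ : ∃ ε, 0 < ε ∧ ε ≤ ε₁ ∧ ε ≤ ε₂ ∧ 4 * ε ≤ η₂ ∧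
      C * ε ≤ 1 / 16 ∧ C * β * ε ≤ 1 / 128 := by
    have h1 : 0 < 1 / (128 * (C + 1) * (β + 1)) := by positivity
    obtain ⟨ε, hεdef⟩ : ∃ ε, ε = min (min ε₁ ε₂) (min (η₂ / 4) (1 / (128 * (C + 1) * (β + 1)))) :=
      ⟨_, rfl⟩
    have h2 : ε ≤ 1 / (128 * (C + 1) * (β + 1)) := by
      rw [hεdef]; exact (min_le_right _ _).trans (min_le_right _ _)
    have h3 : 0 < ε := by
      rw [hεdef]; exact lt_min (lt_min hε₁ hε₂) (lt_min (by positivity) h1)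
    have h4 : ε * (128 * (C + 1) * (β + 1)) ≤ 1 := by rwa [le_div_iff₀ (by positivity)] at h2
    have h5 : 0 ≤ C * ε := by positivity
    have h6 : 0 ≤ C * β * ε := by positivity
    have h7 : 0 ≤ β * ε := by positivity
    refine ⟨ε, h3, ?_, ?_, ?_, by nlinarith, by nlinarith⟩
    · rw [hεdef]; exact (min_le_left _ _).trans (min_le_left _ _)
    · rw [hεdef]; exact (min_le_left _ _).trans (min_le_right _ _)
    · have : ε ≤ η₂ / 4 := by rw [hεdef]; exact (min_le_right _ _).trans (min_le_left _ _)
      linarith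
  -- the interval of `t`
  obtain ⟨δ, hδ, ht⟩ : ∃ δ, 0 < δ ∧ ∀ t ∈ Set.Ioo (-δ) δ, ContinuousAt θ t ∧ ContinuousAt d t ∧
      |d t ^ 2 - d 0 ^ 2| < η₁ ∧ |d t ^ 2 - d 0 ^ 2| < η₂ / 2 ∧
      |(θ t + l) ^ 2 - (1 - d 0 ^ 2)| < η₂ := by
    have h1 : ∀ᶠ t in 𝓝 (0 : ℝ), ContinuousAt θ t :=
      (hθ.eventually (by simp)).mono fun t ht => ht.continuousAt
    have h2 : ∀ᶠ t in 𝓝 (0 : ℝ), ContinuousAt d t :=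
      (hd.eventually (by simp)).mono fun t ht => ht.continuousAt
    have hθc := hθ.continuousAt
    have hdc := hd.continuousAt
    have h3 : Tendsto (fun t => |d t ^ 2 - d 0 ^ 2|) (𝓝 0) (𝓝 0) := by
      have : ContinuousAt (fun t => |d t ^ 2 - d 0 ^ 2|) 0 := by fun_prop
      simpa using this.tendsto
    have h4 : Tendsto (fun t => |(θ t + l) ^ 2 - (1 - d 0 ^ 2)|) (𝓝 0) (𝓝 0) := by
      have : ContinuousAt (fun t => |(θ t + l) ^ 2 - (1 - d 0 ^ 2)|) 0 := by fun_prop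
      have h5 := this.tendsto
      rwa [show (θ 0 + l) ^ 2 - (1 - d 0 ^ 2) = 0 by linarith, abs_zero] at h5
    obtain ⟨δ, hδ, h⟩ := Metric.eventually_nhds_iff.1 (h1.and (h2.and ((h3.eventually
      (gt_mem_nhds hη₁)).and ((h3.eventually (gt_mem_nhds (half_pos hη₂))).and
        (h4.eventually (gt_mem_nhds hη₂))))))
    exact ⟨δ, hδ, fun t ht => h (by rw [Real.dist_eq, sub_zero]; exact abs_lt.2 ht)⟩
  have hs : ∀ t ∈ Set.Ioo (-δ) δ, ‖(d t : ℂ) ^ 2 - ((d 0 ^ 2 : ℝ) : ℂ)‖ < η₁ := fun t h => by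
    rw [← Complex.ofReal_pow, ← Complex.ofReal_sub, Complex.norm_real]
    exact (ht t h).2.2.1
  have hs2 : ∀ t ∈ Set.Ioo (-δ) δ, ‖(d t : ℂ) ^ 2 - ((d 0 ^ 2 : ℝ) : ℂ)‖ < 2 * η₁ := fun t h => by
    linarith [hs t h]
  have hx : ∀ t ∈ Set.Ioo (-δ) δ,
      (((θ t + l) ^ 2 : ℝ) : ℂ) ∈ Metric.ball (((1 - d 0 ^ 2 : ℝ)) : ℂ) η₂ := fun t h => by
    rw [Metric.mem_ball, dist_eq_norm, ← Complex.ofReal_sub, Complex.norm_real]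
    exact (ht t h).2.2.2.2
  have hΛ : ∀ t ∈ Set.Ioo (-δ) δ, ∀ c : ℂ, ‖c‖ < ε →
      1 + hillAmp c - (d t : ℂ) ^ 2 ∈ Metric.ball (((1 - d 0 ^ 2 : ℝ)) : ℂ) η₂ := fun t h c hc => by
    have h1 := norm_hillAmp_le (c := c) (by linarith)
    have h2 := (ht t h).2.2.2.1
    rw [← Real.norm_eq_abs, ← Complex.norm_real] at h2
    rw [Metric.mem_ball, dist_eq_norm]
    have h3 : 1 + hillAmp c - (d t : ℂ) ^ 2 - ((1 - d 0 ^ 2 : ℝ) : ℂ) =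
        hillAmp c - ((d t ^ 2 - d 0 ^ 2 : ℝ) : ℂ) := by push_cast; ring
    rw [h3]
    have := norm_sub_le (hillAmp c) ((d t ^ 2 - d 0 ^ 2 : ℝ) : ℂ)
    linarith
  have hF : ∀ t, ∀ c ∈ upperPart, ‖c‖ < ε → evansE c (θ t) (d t) / (4 * κ) =
      (hillDet c (1 + hillAmp c - (d t : ℂ) ^ 2) * sinSqSqrt (1 + hillAmp c - (d t : ℂ) ^ 2) -
        sinSqSqrt (((θ t + l) ^ 2 : ℝ) : ℂ)) / κ := fun t c hu hc => by
    rw [evansE_eq _ _ _ l, hillCoeff_zero_index (by linarith) hu, 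
      mul_div_mul_left _ _ (by norm_num)]
  have hκn : ‖(κ : ℂ)‖ = |κ| := by rw [Complex.norm_real, Real.norm_eq_abs]
  refine ⟨κ, hκ, ε, hε, hεε₁.trans hε₁2, δ, hδ, 2 + C * β, by positivity, ?_, ?_, ?_, ?_, ?_, ?_⟩
  · intro t h
    have h1 := (ht t h).1
    have h2 := (ht t h).2.1
    exact ContinuousAt.continuousWithinAt (by fun_prop)
  · intro t h c hu hc
    rw [hillCoeff_zero_index (by linarith) hu]
    obtain ⟨-, h2, h3, -⟩ := hdet c hu (by linarith) _ (hs2 t h)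
    exact ⟨h2, h3⟩
  · intro t h c hu hc
    rw [hF t c hu hc]
    have hD := (hdet c hu (by linarith) _ (hs2 t h)).2.2.2
    have hSΛ := hSB _ (hΛ t h c hc)
    have hdiff := hS _ (hΛ t h c hc) _ (hx t h)
    have ha := norm_hillAmp_sub_le (c := c) (by linarith)
    have hΛρ : 1 + hillAmp c - (d t : ℂ) ^ 2 - (((θ t + l) ^ 2 : ℝ) : ℂ) =
        hillAmp c - (((θ t + l) ^ 2 + d t ^ 2 - 1 : ℝ) : ℂ) := by
      push_cast; ring
    rw [hΛρ] at hdiff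
    rw [hBβ] at hSΛ
    have h3 : 2 * ‖c‖ ^ 3 ≤ ‖c‖ ^ 2 := by
      have : ‖c‖ ≤ 1 / 2 := by linarith
      nlinarith [sq_nonneg ‖c‖]
    exact norm_value_error_le hκ hC (sq_nonneg _) hdiff hD hSΛ (ha.trans h3)
  · intro t h p hp hpε c₁ hc₁ c₂ hc₂
    have hball : ∀ c ∈ Metric.ball (Complex.I * p) (p / 4), c ∈ upperPart ∧ ‖c‖ < ε := by
      intro c hc
      rw [Metric.mem_ball, dist_eq_norm] at hc
      have h1 := Complex.abs_im_le_norm (c - Complex.I * p)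
      have h2 := norm_sub_norm_le c (Complex.I * p)
      simp only [Complex.sub_im, Complex.mul_im, Complex.I_re, Complex.I_im, Complex.ofReal_re,
        Complex.ofReal_im, norm_mul, Complex.norm_I, Complex.norm_real, Real.norm_eq_abs,
        abs_of_pos hp] at h1 h2
      have h3 := (abs_le.1 h1).1
      refine ⟨Or.inl (by linarith), by linarith⟩
    obtain ⟨hu₁, hn₁⟩ := hball c₁ hc₁
    obtain ⟨hu₂, hn₂⟩ := hball c₂ hc₂
    rw [hF t c₁ hu₁ hn₁, hF t c₂ hu₂ hn₂]
    have hD₁ := (hdet c₁ hu₁ (by linarith) _ (hs2 t h)).2.2.2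
    have hD₁₂ := hdetc _ (hs2 t h) p hp (by linarith) c₁ hc₁ c₂ hc₂
    have hS₂ := hSB _ (hΛ t h c₂ hn₂)
    have hdiff := hS _ (hΛ t h c₁ hn₁) _ (hΛ t h c₂ hn₂)
    have ha := hamp c₁ (by rw [Metric.mem_ball, dist_zero_right]; linarith)
      c₂ (by rw [Metric.mem_ball, dist_zero_right]; linarith)
    rw [sub_sub_sub_cancel_right, add_sub_add_left_eq_sub] at hdiff
    have hn : ‖Complex.I * (c₁ - c₂)‖ = ‖c₁ - c₂‖ := by
      rw [norm_mul, Complex.norm_I, one_mul]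
    rw [hBβ] at hS₂
    have hD' : C * ‖c₁‖ ^ 2 ≤ 1 / 32 := by
      have h1 : ‖c₁‖ ^ 2 ≤ ε * (1 / 2) := by
        have : ‖c₁‖ ≤ 1 / 2 := by linarith
        nlinarith [norm_nonneg c₁]
      have h2 : C * ‖c₁‖ ^ 2 ≤ C * (ε * (1 / 2)) := mul_le_mul_of_nonneg_left h1 hC
      linarith
    have hD₁₂' : β * (16 * C * p * ‖c₁ - c₂‖) ≤ 1 / 16 * ‖c₁ - c₂‖ := by
      calc β * (16 * C * p * ‖c₁ - c₂‖) = 8 * (C * β * (2 * p)) * ‖c₁ - c₂‖ := by ring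
        _ ≤ 8 * (1 / 128) * ‖c₁ - c₂‖ := by
            refine mul_le_mul_of_nonneg_right (mul_le_mul_of_nonneg_left ?_ (by norm_num))
              (norm_nonneg _)
            exact (mul_le_mul_of_nonneg_left hpε.le (by positivity)).trans hCβε
        _ = _ := by ring
    rw [← hn]
    rw [← hn] at ha hD₁₂'
    exact norm_slope_error_le hκ hdiff (hD₁.trans hD')
      ((mul_le_mul_of_nonneg_left (by rw [hn]; exact hD₁₂) hβ0).trans hD₁₂') hS₂ ha
  · intro c hu hc
    refine ContinuousOn.congr ?_ fun t _ => hF t c hu hc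
    have hdt : ContinuousOn (fun t => (d t : ℂ) ^ 2) (Set.Ioo (-δ) δ) := fun t h => by
      have h2 := (ht t h).2.1
      exact ContinuousAt.continuousWithinAt (by fun_prop)
    have hxt : ContinuousOn (fun t => (((θ t + l) ^ 2 : ℝ) : ℂ)) (Set.Ioo (-δ) δ) := fun t h => by
      have h2 := (ht t h).1
      exact ContinuousAt.continuousWithinAt (by fun_prop)
    have hSc : ContinuousOn sinSqSqrt (Metric.ball (((1 - d 0 ^ 2 : ℝ)) : ℂ) η₂) := by
      have : LipschitzOnWith (Real.toNNReal (2 * |κ|)) sinSqSqrt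
          (Metric.ball (((1 - d 0 ^ 2 : ℝ)) : ℂ) η₂) := by
        refine LipschitzOnWith.of_dist_le_mul fun z₁ h1 z₂ h2 => ?_
        rw [Real.coe_toNNReal _ (by positivity), dist_eq_norm, dist_eq_norm]
        have h3 := hS z₁ h1 z₂ h2
        have h4 := norm_sub_norm_le (sinSqSqrt z₁ - sinSqSqrt z₂) (κ * (z₁ - z₂))
        rw [norm_mul, hκn] at h4
        have h5 : 0 ≤ |κ| * ‖z₁ - z₂‖ := by positivity
        linarith
      exact this.continuousOn
    have hDc : ContinuousOn (fun s : ℂ => hillDet c (1 + hillAmp c - s))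
        (Metric.ball ((d 0 ^ 2 : ℝ) : ℂ) η₁) := by
      have : LipschitzOnWith (Real.toNNReal (C / η₁))
          (fun s : ℂ => hillDet c (1 + hillAmp c - s)) (Metric.ball ((d 0 ^ 2 : ℝ) : ℂ) η₁) := by
        refine LipschitzOnWith.of_dist_le_mul fun s₁ h1 s₂ h2 => ?_
        rw [Metric.mem_ball, dist_eq_norm] at h1 h2
        rw [Real.coe_toNNReal _ (by positivity), dist_eq_norm, dist_eq_norm]
        exact hdets c hu (by linarith) s₁ s₂ h1 h2
      exact this.continuousOn
    have hD' : ContinuousOn (fun t => hillDet c (1 + hillAmp c - (d t : ℂ) ^ 2))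
        (Set.Ioo (-δ) δ) :=
      hDc.comp hdt fun t h => by rw [Metric.mem_ball, dist_eq_norm]; exact hs t h
    have hS₁ : ContinuousOn (fun t => sinSqSqrt (1 + hillAmp c - (d t : ℂ) ^ 2))
        (Set.Ioo (-δ) δ) :=
      hSc.comp (continuousOn_const.sub hdt) fun t h => hΛ t h c hc
    have hS₂ : ContinuousOn (fun t => sinSqSqrt (((θ t + l) ^ 2 : ℝ) : ℂ)) (Set.Ioo (-δ) δ) :=
      hSc.comp hxt fun t h => hx t h
    exact ((hD'.mul hS₁).sub hS₂).div_const _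
  · intro t h y hy hyε
    have hn : ‖Complex.I * (y : ℂ)‖ = y := by
      rw [norm_mul, Complex.norm_I, one_mul, Complex.norm_real, Real.norm_eq_abs, abs_of_pos hy]
    have hu : Complex.I * (y : ℂ) ∈ upperPart := Or.inl (by simpa using hy)
    obtain ⟨h1, -, h3, -⟩ := hdet _ hu (by linarith) _ (hs2 t h)
    rw [← hillCoeff_zero_index (by linarith) hu] at h1 h3
    have h4 := evansE_I_mul_im (θ := θ t) h1 h3
    rw [show (4 * (κ : ℂ)) = ((4 * κ : ℝ) : ℂ) by push_cast; ring, Complex.div_ofReal_im, h4,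
      zero_div]

end

/-! ### The crossing theorem -/

theorem mainTheorem5 (l : ℤ) (θ d : ℝ → ℝ)
    (hθ : ContDiffAt ℝ 1 θ 0) (hd : ContDiffAt ℝ 1 d 0)
    -- at `t = 0` the curve `(θ(t), d(t))` meets the circle `(θ + l)² + d² = 1` ...
    (hcircle : (θ 0 + l) ^ 2 + d 0 ^ 2 = 1)
    -- ... and crosses it from outside to inside, with speed `v > 0` along the inward unit normal
    (v : ℝ) (hv : v = -((θ 0 + l) * deriv θ 0 + d 0 * deriv d 0)) (hv_pos : 0 < v)
    (hd_zero : d 0 ≠ 0)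
    (hd_sqrt : d 0 ≠ Real.sqrt 3 / 2) (hd_neg_sqrt : d 0 ≠ -(Real.sqrt 3 / 2))
    (hd_one : d 0 ≠ 1) (hd_neg_one : d 0 ≠ -1) :
    ∃ ε : ℝ, 0 < ε ∧ ∃ δ : ℝ, 0 < δ ∧
      -- near the crossing Hill's determinant converges, so that the Evans function is well defined
      (∀ t ∈ Set.Ioo (-δ) δ, ∀ c ∈ evansDomain, ‖c‖ < ε →
        (∀ n : ℤ, hillCoeff c 0 - (d t : ℂ) ^ 2 ≠ (n : ℂ) ^ 2) ∧
        Tendsto (hillDetTrunc c (hillCoeff c 0 - (d t : ℂ) ^ 2)) atTop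
          (𝓝 (hillDet c (hillCoeff c 0 - (d t : ℂ) ^ 2)))) ∧
      -- no root near the origin before the crossing, and only `c = 0` at the crossing
      (∀ t ∈ Set.Ioo (-δ) 0, evansRootsNear ε (θ t) (d t) = ∅) ∧
      evansRootsNear ε (θ 0) (d 0) = {0} ∧
      -- after it exactly one pair `c = ± i y(t)` with `y(t) > 0`, which leaves `0` with `± 2 i v`
      ∃ y : ℝ → ℝ, y 0 = 0 ∧ ContinuousOn y (Set.Ico 0 δ) ∧
        (∀ t ∈ Set.Ioo 0 δ, 0 < y t ∧
          evansRootsNear ε (θ t) (d t) = {Complex.I * (y t : ℂ), -(Complex.I * (y t : ℂ))}) ∧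
        HasDerivWithinAt (fun t : ℝ => Complex.I * (y t : ℂ))
          (2 * (v : ℂ) * Complex.I) (Set.Ici 0) 0 ∧
        HasDerivWithinAt (fun t : ℝ => -(Complex.I * (y t : ℂ)))
          (-(2 * (v : ℂ) * Complex.I)) (Set.Ici 0) 0 := by
  have hd0 : 0 < d 0 ^ 2 := by positivity
  have hd1 : d 0 ^ 2 < 1 := by
    have h1 : d 0 ^ 2 ≤ 1 := by nlinarith [sq_nonneg (θ 0 + l)]
    refine lt_of_le_of_ne h1 fun h => ?_
    rcases sq_eq_one_iff.1 h with h | h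
    · exact hd_one h
    · exact hd_neg_one h
  have hd34 : d 0 ^ 2 ≠ 3 / 4 := fun h => by
    have h1 : (Real.sqrt 3 / 2) ^ 2 = 3 / 4 := by
      rw [div_pow, Real.sq_sqrt (by norm_num)]; norm_num
    rcases sq_eq_sq_iff_eq_or_eq_neg.1 (h.trans h1.symm) with h | h
    · exact hd_sqrt h
    · exact hd_neg_sqrt h
  obtain ⟨κ, hκ, ε₀, hε₀, hε₀2, δ₀, hδ₀, K, hK, hρc, hconv, happrox, hslope, hcont, hreal⟩ :=
    exists_evansE_estimates l hθ hd hcircle hd0 hd1 hd34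
  have hρ : HasDerivAt (fun t => (θ t + l) ^ 2 + d t ^ 2 - 1) (-(2 * v)) 0 := by
    have h1 := (hθ.differentiableAt one_ne_zero).hasDerivAt
    have h2 := (hd.differentiableAt one_ne_zero).hasDerivAt
    have h3 := (((h1.add_const (l : ℝ)).pow 2).add (h2.pow 2)).sub_const 1
    refine HasDerivAt.congr_deriv (f := fun t => (θ t + l) ^ 2 + d t ^ 2 - 1) h3 ?_
    rw [hv]
    push_cast
    ring
  obtain ⟨ε, hε, hεε₀, δ, hδ, hδδ₀, hneg, hzero, y, hy0, hyc, hy, hyd⟩ :=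
    exists_root_curve (F := fun c t => evansE c (θ t) (d t) / (4 * κ)) hε₀ hδ₀ hK hv_pos hρc
      (by linarith) hρ happrox
      (fun t ht p _ hp hpε => hslope t ht p hp hpε) hcont hreal
  have hF : ∀ c t, evansE c (θ t) (d t) / (4 * κ) = 0 ↔ evansE c (θ t) (d t) = 0 := fun c t => by
    have : (4 * κ : ℂ) ≠ 0 := mul_ne_zero (by norm_num) (by exact_mod_cast hκ)
    rw [div_eq_zero_iff, or_iff_left this]
  simp only [hF, ne_eq] at hneg hzero hy
  have hone : ∀ {c : ℂ}, ‖c‖ < ε → ‖c‖ < 1 := fun h => by linarith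
  have hmem : ∀ {t : ℝ}, t ∈ Set.Ioo (-δ) δ → t ∈ Set.Ioo (-δ₀) δ₀ := fun ht =>
    ⟨by linarith [ht.1], by linarith [ht.2]⟩
  refine ⟨ε, hε, δ, hδ, ?_, ?_, ?_, y, hy0, hyc, ?_, ?_, ?_⟩
  · intro t ht c hc hcε
    rcases mem_upperPart_or_neg_mem hc (hone hcε) with hu | hu
    · exact hconv t (hmem ht) c hu (by linarith)
    · have h1 := hconv t (hmem ht) (-c) hu (by rw [norm_neg]; linarith)
      have h2 : hillCoeff (-c) 0 = hillCoeff c 0 := by rw [hillCoeff_neg, neg_zero]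
      have h3 : ∀ Λ, hillDetTrunc (-c) Λ = hillDetTrunc c Λ :=
        fun Λ => funext fun N => hillDetTrunc_neg c Λ N
      rwa [h2, h3, hillDet_neg] at h1
  · intro t ht
    rw [Set.eq_empty_iff_forall_notMem]
    rintro c ⟨hc, hcε, h0⟩
    rcases mem_upperPart_or_neg_mem hc (hone hcε) with hu | hu
    · exact hneg t ht c hu hcε h0
    · exact hneg t ht (-c) hu (by rwa [norm_neg]) (by rwa [evansE_neg])
  · ext c
    rw [Set.mem_singleton_iff]
    constructor
    · rintro ⟨hc, hcε, h0⟩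
      rcases mem_upperPart_or_neg_mem hc (hone hcε) with hu | hu
      · exact (hzero c hu hcε).1 h0
      · exact neg_eq_zero.1 ((hzero (-c) hu (by rwa [norm_neg])).1 (by rwa [evansE_neg]))
    · rintro rfl
      have h0 : ‖(0 : ℂ)‖ < ε := by rwa [norm_zero]
      exact ⟨Or.inl rfl, h0, (hzero 0 (Or.inr rfl) h0).2 rfl⟩
  · intro t ht
    obtain ⟨hyt, hyε, hroot⟩ := hy t ht
    refine ⟨hyt, ?_⟩
    have hn : ‖Complex.I * (y t : ℂ)‖ < ε := by
      rwa [norm_mul, Complex.norm_I, one_mul, Complex.norm_real, Real.norm_eq_abs,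
        abs_of_pos hyt]
    have him : (Complex.I * (y t : ℂ)).im = y t := by simp
    have hE : evansE (Complex.I * (y t : ℂ)) (θ t) (d t) = 0 :=
      (hroot _ (Or.inl (by rwa [him])) hn).2 rfl
    ext c
    rw [Set.mem_insert_iff, Set.mem_singleton_iff]
    constructor
    · rintro ⟨hc, hcε, h0⟩
      rcases mem_upperPart_or_neg_mem hc (hone hcε) with hu | hu
      · exact Or.inl ((hroot c hu hcε).1 h0)
      · exact Or.inr (neg_eq_iff_eq_neg.1
          ((hroot (-c) hu (by rwa [norm_neg])).1 (by rwa [evansE_neg])))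
    · rintro (rfl | rfl)
      · exact ⟨mem_evansDomain_of_im_ne_zero (by rw [him]; exact hyt.ne'), hn, hE⟩
      · exact ⟨mem_evansDomain_of_im_ne_zero
            (by rw [Complex.neg_im, him]; exact (neg_neg_of_pos hyt).ne),
          by rwa [norm_neg], by rwa [evansE_neg]⟩
  · refine (hyd.ofReal_comp.const_mul Complex.I).congr_deriv ?_
    push_cast
    ring
  · refine (hyd.ofReal_comp.const_mul Complex.I).neg.congr_deriv ?_
    push_cast
    ring
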